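/- Let $k\in\mathbb Z$, let $f,g,h$ be linearly independent (holomorphic) modular forms of weight $k$ on $\mathrm{SL}(2,\mathbb Z)$ with trivial character, and let $$W=W_{f,g,h}=\det\begin{pmatrix} f&f'&f''\\ g&g'&g''\\ h&h'&h''\end{pmatrix},\qquad {}'=\frac{d}{dz}.$$ Then there is a differential equation $$y'''+Q_2(z)y'+Q_3(z)y=0,\qquad z\in\mathbb H=\{\operatorname{Im}z>0\},\qquad(\ast)$$ with $Q_2,Q_3$ meromorphic on $\mathbb H$, which is satisfied by the (multivalued) functions $f/\sqrt[3]{W}$, $g/\sqrt[3]{W}$, $h/\sqrt[3]{W}$, and $Q_2,Q_3$ are unique as meromorphic functions. It has the following properties. 1. $(\ast)$ is a modular ordinary differential equation (MODE): $Q_2$ and $Q_3-\frac12Q_2'$ are meromorphic modular forms (meromorphic also at $\infty$) on $\mathrm{SL}(2,\mathbb Z)$, with trivial character, of weight $4$ and $6$ respectively. 2. (H1) $(\ast)$ is Fuchsian on $\mathbb H\cup\{\infty\}$: at every point of $\mathbb H$ the order of a pole of $Q_j$ is at most $j$ ($j=2,3$), and $Q_2,Q_3$ are holomorphic at $\infty$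 as functions of $q=e^{2\pi i z}$. 3. (H2) At every singular point $z_0\in\mathbb H$ (pole of $Q_2$ or $Q_3$) the local exponents are real numbers $\kappa^{(1)}_{z_0}<\kappa^{(2)}_{z_0}<\kappa^{(3)}_{z_0}$ with $\kappa^{(1)}_{z_0}\in\frac13\mathbb Z_{\le0}$ and $\kappa^{(j)}_{z_0}-\kappa^{(1)}_{z_0}\in\mathbb Z$ for $j=2,3$, and $z_0$ is apparent, i.e. no local solution of $(\ast)$ at $z_0$ has a logarithmic singularity. 4. (H3) At the cusp $\infty$ (the only cusp of $\mathrm{SL}(2,\mathbb Z)$) the local exponents are real numbers $\kappa^{(1)}_\infty\le\kappa^{(2)}_\infty\le\kappa^{(3)}_\infty$ with $\kappa^{(1)}_\infty\in\frac13\mathbb Z_{\le0}$ and $\kappa^{(j)}_\infty-\kappa^{(1)}_\infty\in\mathbb Z$ for $j=2,3$. 5. $(\ast)$ is also apparent at $\infty$: no solution on a half plane $\operatorname{Im}z>Y$ has a logarithmic singularity at $q=0$. 6. At the elliptic point $i$ the local exponents $\kappa_i^{(1)}\le\kappa_i^{(2)}\le\kappa_i^{(3)}$ satisfy $\kappa_i^{(2)}-\kappa_i^{(1)}\equiv\kappa_i^{(3)}-\kappa_i^{(1)}\equiv0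 \pmod 2$. 7. At the elliptic point $\rho=\frac{-1+\sqrt3\,i}2$ the local exponents are integers and $\kappa_\rho^{(1)}\equiv\kappa_\rho^{(2)}\equiv\kappa_\rho^{(3)}\pmod 3$. Here the local exponents at $z_0\in\mathbb H$ are the roots, with multiplicity, of $\kappa(\kappa-1)(\kappa-2)+A_2\kappa+A_3=0$, where $Q_j(z)=A_j(z-z_0)^{-j}+O((z-z_0)^{-j+1})$, and those at $\infty$ are the roots, with multiplicity, of $\kappa^3+\frac{Q_2(\infty)}{(2\pi i)^2}\kappa+\frac{Q_3(\infty)}{(2\pi i)^3}=0$. A solution has no logarithmic singularity at $z_0$ (resp. at $\infty$) if near it, on a disc around $z_0$ slit along $z_0+(-\infty,0]$ (resp. for $\operatorname{Im}z$ large), it is a finite sum of terms $(z-z_0)^{\alpha}H(z)$ with $\alpha\in\mathbb C$ and $H$ holomorphic at $z_0$ (resp. terms $q^\alpha H(q)=e^{2\pi i\alpha z}H(e^{2\pi iz})$ with $H$ holomorphic at $0$). -/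

import Mathlib

open Complex
open scoped Topology UpperHalfPlane MatrixGroups Polynomial

noncomputable section

namespace ThirdOrderMODE

/-- The upper half plane as an open subset of `ℂ`. -/
def upperHalf : Set ℂ := {z : ℂ | 0 < z.im}

/-- A function on the upper half plane, regarded as a function of a complex variable (only its
values on `upperHalf` matter). -/
def toPlane (f : ℍ → ℂ) : ℂ → ℂ := fun z => f (UpperHalfPlane.ofComplex z)

/-- The Wronskian determinant of three functions of a complex variable. -/
def wronskian (u v w : ℂ → ℂ) : ℂ → ℂ := fun z =>
  Matrix.det !![u z, deriv u z, deriv (deriv u) z;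
                v z, deriv v z, deriv (deriv v) z;
                w z, deriv w z, deriv (deriv w) z]

/-- `y` is a single-valued holomorphic solution of `y''' + Q₂ y' + Q₃ y = 0` on the open set `U`.
The coefficients are meromorphic functions, so the equation is an identity of meromorphic functions,
that is, it holds off a discrete subset of `U`. -/
def IsSolutionOn (Q₂ Q₃ : ℂ → ℂ) (U : Set ℂ) (y : ℂ → ℂ) : Prop :=
  AnalyticOnNhd ℂ y U ∧
    ∀ᶠ z in Filter.codiscreteWithin U,
      deriv (deriv (deriv y)) z + Q₂ z * deriv y z + Q₃ z * y z = 0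

/-- `y''' + Q₂ y' + Q₃ y = 0`, with `Q₂` and `Q₃` meromorphic on the upper half plane, is satisfied
by the multivalued functions `f / ∛W`, `g / ∛W`, `h / ∛W`, where `W` is the Wronskian of `f, g, h`:
it is satisfied for every holomorphic branch `c` of `∛W` on every open set where `W` has no
zeros. -/
structure IsEquationOf (f g h : ℂ → ℂ) (Q₂ Q₃ : ℂ → ℂ) : Prop where
  meromorphic₂ : MeromorphicOn Q₂ upperHalf
  meromorphic₃ : MeromorphicOn Q₃ upperHalf
  satisfied : ∀ (U : Set ℂ) (c : ℂ → ℂ), IsOpen U → U ⊆ upperHalf → AnalyticOnNhd ℂ c U →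
    (∀ z ∈ U, c z ^ 3 = wronskian f g h z) → (∀ z ∈ U, wronskian f g h z ≠ 0) →
    IsSolutionOn Q₂ Q₃ U (fun z => f z / c z) ∧
    IsSolutionOn Q₂ Q₃ U (fun z => g z / c z) ∧
    IsSolutionOn Q₂ Q₃ U (fun z => h z / c z)

/-- `F(z) = G(q)`, `q = exp (2πiz)`, near the cusp `∞`, as an identity of meromorphic functions on
some half plane `Im z > Y`. -/
def HasQExpansion (F G : ℂ → ℂ) : Prop :=
  ∃ Y : ℝ, ∀ᶠ z in Filter.codiscreteWithin {z : ℂ | Y < z.im},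
    F z = G (exp (2 * Real.pi * I * z))

/-- Meromorphic modular forms of weight `k` on `SL(2,ℤ)`, with trivial character: meromorphic on the
upper half plane, modular of weight `k`, and meromorphic at `∞`. -/
structure IsMeromorphicModularForm (k : ℤ) (F : ℂ → ℂ) : Prop where
  meromorphic : MeromorphicOn F upperHalf
  modular : ∀ γ : SL(2, ℤ), ∀ᶠ z in Filter.codiscreteWithin upperHalf,
    F (((γ 0 0 : ℂ) * z + (γ 0 1 : ℂ)) / ((γ 1 0 : ℂ) * z + (γ 1 1 : ℂ))) =
      ((γ 1 0 : ℂ) * z + (γ 1 1 : ℂ)) ^ k * F z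
  meromorphic_infty : ∃ G : ℂ → ℂ, MeromorphicAt G 0 ∧ HasQExpansion F G

/-- `y''' + Q₂ y' + Q₃ y = 0` is a modular ordinary differential equation on `SL(2,ℤ)`. -/
structure IsMODE (Q₂ Q₃ : ℂ → ℂ) : Prop where
  weight_four : IsMeromorphicModularForm 4 Q₂
  weight_six : IsMeromorphicModularForm 6 (fun z => Q₃ z - (1 / 2) * deriv Q₂ z)

/-- `F` is holomorphic at `∞` with value `F(∞) = v`. -/
def HasValueAtInfty (F : ℂ → ℂ) (v : ℂ) : Prop :=
  ∃ G : ℂ → ℂ, AnalyticAt ℂ G 0 ∧ G 0 = v ∧ HasQExpansion F G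

/-- `κ 0 ≤ κ 1 ≤ κ 2` are the local exponents at the point `z₀`: the roots, with multiplicity, of
the indicial equation `κ(κ-1)(κ-2) + A₂ κ + A₃ = 0`, where
`Q_j = A_j (z - z₀)^(-j) + O((z - z₀)^(-j+1))`. -/
def IsLocalExponents (Q₂ Q₃ : ℂ → ℂ) (z₀ : ℂ) (κ : Fin 3 → ℝ) : Prop :=
  Monotone κ ∧ ∃ A₂ A₃ : ℂ,
    Filter.Tendsto (fun z => (z - z₀) ^ 2 * Q₂ z) (𝓝[≠] z₀) (𝓝 A₂) ∧
    Filter.Tendsto (fun z => (z - z₀) ^ 3 * Q₃ z) (𝓝[≠] z₀) (𝓝 A₃) ∧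
    (Polynomial.X * (Polynomial.X - 1) * (Polynomial.X - 2) +
        Polynomial.C A₂ * Polynomial.X + Polynomial.C A₃ : ℂ[X]) =
      ∏ j : Fin 3, (Polynomial.X - Polynomial.C (κ j : ℂ))

/-- `κ 0 ≤ κ 1 ≤ κ 2` are the local exponents at the cusp `∞` (of width one): the roots, with
multiplicity, of `κ³ + (2πi)⁻² Q₂(∞) κ + (2πi)⁻³ Q₃(∞) = 0`. -/
def IsLocalExponentsAtInfty (Q₂ Q₃ : ℂ → ℂ) (κ : Fin 3 → ℝ) : Prop :=
  Monotone κ ∧ ∃ v₂ v₃ : ℂ, HasValueAtInfty Q₂ v₂ ∧ HasValueAtInfty Q₃ v₃ ∧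
    (Polynomial.X ^ 3 + Polynomial.C (v₂ / (2 * Real.pi * I) ^ 2) * Polynomial.X +
        Polynomial.C (v₃ / (2 * Real.pi * I) ^ 3) : ℂ[X]) =
      ∏ j : Fin 3, (Polynomial.X - Polynomial.C (κ j : ℂ))

/-- `z₀` is a singular point of the equation: a pole of one of the coefficients. -/
def IsSingularPoint (Q₂ Q₃ : ℂ → ℂ) (z₀ : ℂ) : Prop :=
  meromorphicOrderAt Q₂ z₀ < 0 ∨ meromorphicOrderAt Q₃ z₀ < 0

/-- The equation is apparent at `z₀`: no local solution has a logarithmic singularity. Local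
solutions are single-valued holomorphic functions on a disc around `z₀` slit along
`z₀ + (-∞, 0]`. By Frobenius' theory they are combinations, with coefficients holomorphic at `z₀`,
of functions `(z - z₀)^α (log (z - z₀))^m`; no logarithm occurs when all `m` are `0`. -/
def IsApparentAt (Q₂ Q₃ : ℂ → ℂ) (z₀ : ℂ) : Prop :=
  ∀ (r : ℝ) (y : ℂ → ℂ), 0 < r → Metric.ball z₀ r ⊆ upperHalf →
    IsSolutionOn Q₂ Q₃ {z | z ∈ Metric.ball z₀ r ∧ z - z₀ ∈ slitPlane} y →
    ∃ (n : ℕ) (α : Fin n → ℂ) (H : Fin n → ℂ → ℂ), (∀ j, AnalyticAt ℂ (H j) z₀) ∧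
      ∀ᶠ z in 𝓝[{z | z - z₀ ∈ slitPlane}] z₀, y z = ∑ j, (z - z₀) ^ α j * H j z

/-- The equation is apparent at the cusp `∞`: no solution on a half plane `Im z > Y` has a
logarithmic singularity at `q = 0`, where `q = exp (2πiz)`, `log q = 2πiz` and
`q^α = exp (2πiαz)`. -/
def IsApparentAtInfty (Q₂ Q₃ : ℂ → ℂ) : Prop :=
  ∀ (Y : ℝ) (y : ℂ → ℂ), 0 ≤ Y → IsSolutionOn Q₂ Q₃ {z | Y < z.im} y →
    ∃ (n : ℕ) (α : Fin n → ℂ) (H : Fin n → ℂ → ℂ), (∀ j, AnalyticAt ℂ (H j) 0) ∧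
      ∃ Y' : ℝ, ∀ z : ℂ, Y' < z.im →
        y z = ∑ j, exp (2 * Real.pi * I * α j * z) * H j (exp (2 * Real.pi * I * z))

/-- (H1): the equation is Fuchsian on the upper half plane and at the cusp. -/
structure H1 (Q₂ Q₃ : ℂ → ℂ) : Prop where
  pole₂ : ∀ z₀ ∈ upperHalf, ((-2 : ℤ) : WithTop ℤ) ≤ meromorphicOrderAt Q₂ z₀
  pole₃ : ∀ z₀ ∈ upperHalf, ((-3 : ℤ) : WithTop ℤ) ≤ meromorphicOrderAt Q₃ z₀
  infty₂ : ∃ v, HasValueAtInfty Q₂ v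
  infty₃ : ∃ v, HasValueAtInfty Q₃ v

/-- (H2): at every singular point in the upper half plane the local exponents are distinct, the
smallest one lies in `(1/3) ℤ_{≤ 0}`, the exponent differences are integers, and the point is
apparent. -/
def H2 (Q₂ Q₃ : ℂ → ℂ) : Prop :=
  ∀ z₀ ∈ upperHalf, IsSingularPoint Q₂ Q₃ z₀ →
    (∃ κ : Fin 3 → ℝ, IsLocalExponents Q₂ Q₃ z₀ κ ∧ StrictMono κ ∧
      (∃ n : ℕ, κ 0 = -(n : ℝ) / 3) ∧ ∀ j, ∃ m : ℤ, κ j - κ 0 = m) ∧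
    IsApparentAt Q₂ Q₃ z₀

/-- (H3): at the cusp `∞`, the only one of `SL(2,ℤ)`, the smallest local exponent lies in
`(1/3) ℤ_{≤ 0}` and the exponent differences are integers. -/
def H3 (Q₂ Q₃ : ℂ → ℂ) : Prop :=
  ∃ κ : Fin 3 → ℝ, IsLocalExponentsAtInfty Q₂ Q₃ κ ∧
    (∃ n : ℕ, κ 0 = -(n : ℝ) / 3) ∧ ∀ j, ∃ m : ℤ, κ j - κ 0 = m

/-- The elliptic point `ρ = (-1 + √3 i) / 2`. -/
def rho : ℂ := (-1 + (Real.sqrt 3 : ℂ) * I) / 2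

end ThirdOrderMODE

end

/-!
The argument rests on one observation: near every point `z₀` of the upper half plane, and in the
variable `q` near the cusp, the solution space can be written down explicitly. Since the germs of
`f, g, h` are linearly independent, their span has a basis of germs `t ^ n j * U j` with
`n 0 < n 1 < n 2`, where `t = z - z₀` or `t = q` and `U j` does not vanish at the centre
(`exists_echelon`). The leading coefficient of their Wronskian is a Vandermonde determinant in the
`n j`, so `W` does not vanish identically (`frequently_wronskian_ne_zero`) and `W = t ^ w * C ^ 3`
with `C` analytic and nonzero at the centre. Hence the quotients by `∛W` are spanned by
`t ^ (n j - w / 3) * (U j / C)`.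

Substituting these three functions into the equation gives a linear system for the coefficients
`t ^ 2 * Q₂` and `t ^ 3 * Q₃` (at the cusp, for `Q₂` and `Q₃` up to powers of `2πi`), whose
determinant at the centre is again of Vandermonde type. So the coefficients are analytic and are
determined by `f, g, h` (`exists_local_coefficients`,
`HasIndependentQExpansions.exists_coefficients`). This yields uniqueness and the Fuchsian
conditions, and shows that the `n j - w / 3` are the local exponents. As the equation has no term
in `y''`, the sum of the exponents is `3` at a point of the upper half plane and `0` at the cusp,
which makes the smallest one nonpositive. Moreover, Wronskians of solutions are constant, so three
solutions with nonvanishing Wronskian span all of them (`IsSolutionOn.exists_lincomb`); therefore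
every solution is a combination of the functions above, and no logarithm occurs.

Existence is Cramer's rule followed by the removal of the term in `y''` (`exists_isEquationOf`). For
modularity, Bol's lemma (`deriv_bol`) shows that the pullback of the equation under a modular
transformation is again an equation for `f, g, h` (`IsEquationOf.pullback`), and uniqueness turns
this into the transformation laws of `Q₂` and `Q₃`. Finally, an element of the stabilizer of an
elliptic point acts on the tangent space by a root of unity `μ`, and comparing leading coefficients
in the transformation law of the forms gives one value for all the `μ ^ n j` (`multiplier_pow_eq`).
Thus the `n j` are congruent modulo `2` at `i` and modulo `3` at `ρ`.
-/

noncomputable section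

namespace ThirdOrderMODE

open Filter

/-! ### Codiscrete sets and open sets -/

lemma eventually_codiscreteWithin_iff {S : Set ℂ} (hS : IsOpen S) {P : ℂ → Prop} :
    (∀ᶠ z in codiscreteWithin S, P z) ↔ ∀ x ∈ S, ∀ᶠ z in 𝓝[≠] x, P z := by
  rw [Filter.Eventually, mem_codiscreteWithin_iff_forall_mem_nhdsNE]
  refine forall₂_congr fun x hx => ?_
  constructor
  · intro h
    have hS' : S ∈ 𝓝[≠] x := nhdsWithin_le_nhds (hS.mem_nhds hx)
    filter_upwards [h, hS'] with z hz hzS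
    rcases hz with hz | hz
    · exact hz
    · exact absurd hzS hz
  · intro h
    filter_upwards [h] with z hz using Or.inl hz

lemma frequently_of_eventually_codiscreteWithin {S : Set ℂ} (hS : IsOpen S) {P : ℂ → Prop}
    (h : ∀ᶠ z in codiscreteWithin S, P z) {x : ℂ} (hx : x ∈ closure S) :
    ∃ᶠ z in 𝓝[S] x, P z := by
  rw [frequently_iff]
  intro V hV
  obtain ⟨O, hO, hxO, hOV⟩ := mem_nhdsWithin.1 hV
  obtain ⟨s, hsO, hsS⟩ := mem_closure_iff.1 hx O hO hxO
  have h1 := (eventually_codiscreteWithin_iff hS).1 h s hsS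
  have h2 : O ∩ S ∈ 𝓝[≠] s := nhdsWithin_le_nhds ((hO.inter hS).mem_nhds ⟨hsO, hsS⟩)
  obtain ⟨t, ht1, ht2⟩ := (h1.and h2).exists
  exact ⟨t, hOV ht2, ht1⟩

/-- A continuous function on an open set that vanishes on a codiscrete subset vanishes. -/
lemma eq_zero_of_eventually_codiscreteWithin {S : Set ℂ} (hS : IsOpen S) {E : ℂ → ℂ}
    (hE : ∀ z ∈ S, ContinuousAt E z) (h : ∀ᶠ z in codiscreteWithin S, E z = 0) :
    ∀ z ∈ S, E z = 0 := by
  intro z hz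
  have h1 := (eventually_codiscreteWithin_iff hS).1 h z hz
  have h2 : Tendsto E (𝓝[≠] z) (𝓝 (E z)) := (hE z hz).tendsto.mono_left nhdsWithin_le_nhds
  exact tendsto_nhds_unique_of_eventuallyEq h2 tendsto_const_nhds h1

lemma isOpen_upperHalf : IsOpen upperHalf := isOpen_lt continuous_const Complex.continuous_im

/-! ### Linear systems in three unknowns -/

/-- The determinant of the `3 × 3` matrix with columns `a, b, c`. -/
def det3 (a b c : Fin 3 → ℂ) : ℂ :=
  a 0 * (b 1 * c 2 - b 2 * c 1) - a 1 * (b 0 * c 2 - b 2 * c 0) + a 2 * (b 0 * c 1 - b 1 * c 0)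

/-- Cramer's rule. -/
lemma cramer_iff {w v₂ v₁ v₀ : Fin 3 → ℂ} (hd : det3 v₂ v₁ v₀ ≠ 0) (x₂ x₁ x₀ : ℂ) :
    (∀ j, w j + x₂ * v₂ j + x₁ * v₁ j + x₀ * v₀ j = 0) ↔
      x₂ = -det3 w v₁ v₀ / det3 v₂ v₁ v₀ ∧ x₁ = -det3 v₂ w v₀ / det3 v₂ v₁ v₀ ∧
        x₀ = -det3 v₂ v₁ w / det3 v₂ v₁ v₀ := by
  constructor
  · intro h
    have h0 := h 0
    have h1 := h 1
    have h2 := h 2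
    refine ⟨?_, ?_, ?_⟩ <;> rw [eq_div_iff hd] <;> simp only [det3]
    · linear_combination (v₁ 1 * v₀ 2 - v₁ 2 * v₀ 1) * h0 - (v₁ 0 * v₀ 2 - v₁ 2 * v₀ 0) * h1 +
        (v₁ 0 * v₀ 1 - v₁ 1 * v₀ 0) * h2
    · linear_combination -(v₂ 1 * v₀ 2 - v₂ 2 * v₀ 1) * h0 + (v₂ 0 * v₀ 2 - v₂ 2 * v₀ 0) * h1 -
        (v₂ 0 * v₀ 1 - v₂ 1 * v₀ 0) * h2
    · linear_combination (v₂ 1 * v₁ 2 - v₂ 2 * v₁ 1) * h0 - (v₂ 0 * v₁ 2 - v₂ 2 * v₁ 0) * h1 +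
        (v₂ 0 * v₁ 1 - v₂ 1 * v₁ 0) * h2
  · rintro ⟨rfl, rfl, rfl⟩ j
    have key : w j * det3 v₂ v₁ v₀ = det3 w v₁ v₀ * v₂ j + det3 v₂ w v₀ * v₁ j +
        det3 v₂ v₁ w * v₀ j := by
      fin_cases j <;> simp [det3] <;> ring
    field_simp
    linear_combination key

lemma det3_vandermonde_ne_zero {κ u : Fin 3 → ℂ} (hκ : Function.Injective κ) (hu : ∀ j, u j ≠ 0)
    (α : ℂ) : det3 (fun j => κ j * (κ j - α) * u j) (fun j => κ j * u j) u ≠ 0 := by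
  have h01 : κ 0 - κ 1 ≠ 0 := sub_ne_zero.2 (hκ.ne (by decide))
  have h02 : κ 0 - κ 2 ≠ 0 := sub_ne_zero.2 (hκ.ne (by decide))
  have h12 : κ 1 - κ 2 ≠ 0 := sub_ne_zero.2 (hκ.ne (by decide))
  have : det3 (fun j => κ j * (κ j - α) * u j) (fun j => κ j * u j) u =
      (κ 0 - κ 1) * (κ 0 - κ 2) * (κ 1 - κ 2) * (u 0 * u 1 * u 2) := by
    simp only [det3]; ring
  rw [this]
  exact mul_ne_zero (mul_ne_zero (mul_ne_zero h01 h02) h12)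
    (mul_ne_zero (mul_ne_zero (hu 0) (hu 1)) (hu 2))

lemma AnalyticAt.det3 {a b c : Fin 3 → ℂ → ℂ} {z : ℂ} (ha : ∀ j, AnalyticAt ℂ (a j) z)
    (hb : ∀ j, AnalyticAt ℂ (b j) z) (hc : ∀ j, AnalyticAt ℂ (c j) z) :
    AnalyticAt ℂ (fun z => det3 (a · z) (b · z) (c · z)) z := by
  have := ha 0; have := ha 1; have := ha 2
  have := hb 0; have := hb 1; have := hb 2
  have := hc 0; have := hc 1; have := hc 2
  unfold ThirdOrderMODE.det3
  fun_prop

/-- A linear system with analytic coefficients, nonsingular at `t₀`, has a unique solution near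
`t₀`, and this solution is analytic. -/
lemma exists_analytic_solution {w v₂ v₁ v₀ : Fin 3 → ℂ → ℂ} {t₀ : ℂ}
    (hw : ∀ j, AnalyticAt ℂ (w j) t₀) (h₂ : ∀ j, AnalyticAt ℂ (v₂ j) t₀)
    (h₁ : ∀ j, AnalyticAt ℂ (v₁ j) t₀) (h₀ : ∀ j, AnalyticAt ℂ (v₀ j) t₀)
    (hd : det3 (v₂ · t₀) (v₁ · t₀) (v₀ · t₀) ≠ 0) :
    ∃ b₂ b₁ b₀ : ℂ → ℂ, AnalyticAt ℂ b₂ t₀ ∧ AnalyticAt ℂ b₁ t₀ ∧ AnalyticAt ℂ b₀ t₀ ∧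
      ∀ᶠ t in 𝓝 t₀, ∀ x₂ x₁ x₀ : ℂ,
        (∀ j, w j t + x₂ * v₂ j t + x₁ * v₁ j t + x₀ * v₀ j t = 0) ↔
          x₂ = b₂ t ∧ x₁ = b₁ t ∧ x₀ = b₀ t := by
  have hD := AnalyticAt.det3 h₂ h₁ h₀
  refine ⟨fun t => -det3 (w · t) (v₁ · t) (v₀ · t) / det3 (v₂ · t) (v₁ · t) (v₀ · t),
    fun t => -det3 (v₂ · t) (w · t) (v₀ · t) / det3 (v₂ · t) (v₁ · t) (v₀ · t),
    fun t => -det3 (v₂ · t) (v₁ · t) (w · t) / det3 (v₂ · t) (v₁ · t) (v₀ · t),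
    (AnalyticAt.det3 hw h₁ h₀).neg.div hD hd, (AnalyticAt.det3 h₂ hw h₀).neg.div hD hd,
    (AnalyticAt.det3 h₂ h₁ hw).neg.div hD hd, ?_⟩
  filter_upwards [hD.continuousAt.eventually_ne hd] with t ht x₂ x₁ x₀
  exact cramer_iff ht x₂ x₁ x₀

/-- A monic cubic polynomial with three distinct known roots splits accordingly. -/
lemma cubic_eq_prod {κ : Fin 3 → ℂ} (hκ : Function.Injective κ) {p : ℂ[X]} {a b c : ℂ}
    (hp : p = Polynomial.X ^ 3 + Polynomial.C a * Polynomial.X ^ 2 + Polynomial.C b * Polynomial.X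
      + Polynomial.C c) (h : ∀ j, κ j ^ 3 + a * κ j ^ 2 + b * κ j + c = 0) :
    p = ∏ j, (Polynomial.X - Polynomial.C (κ j)) ∧ a = -(κ 0 + κ 1 + κ 2) := by
  have h01 : κ 0 - κ 1 ≠ 0 := sub_ne_zero.2 (hκ.ne (by decide))
  have h02 : κ 0 - κ 2 ≠ 0 := sub_ne_zero.2 (hκ.ne (by decide))
  have h12 : κ 1 - κ 2 ≠ 0 := sub_ne_zero.2 (hκ.ne (by decide))
  have e0 := h 0
  have e1 := h 1
  have e2 := h 2
  have ha : a = -(κ 0 + κ 1 + κ 2) := by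
    apply mul_left_cancel₀ (mul_ne_zero (mul_ne_zero h01 h02) h12)
    linear_combination (κ 1 - κ 2) * e0 - (κ 0 - κ 2) * e1 + (κ 0 - κ 1) * e2
  have hb : b = κ 0 * κ 1 + κ 0 * κ 2 + κ 1 * κ 2 := by
    apply mul_left_cancel₀ h01
    rw [ha] at e0 e1
    linear_combination e0 - e1
  have hc : c = -(κ 0 * κ 1 * κ 2) := by
    rw [ha, hb] at e0
    linear_combination e0
  refine ⟨?_, ha⟩
  rw [hp, Fin.prod_univ_three, ha, hb, hc]
  simp only [map_add, map_neg, map_mul]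
  ring

/-! ### Wronskians and third-order equations -/

/-- Iterated derivatives from a chain of derivatives. -/
lemma deriv_chain {y y₁ y₂ : ℂ → ℂ} {y₃ z : ℂ} (h₁ : ∀ᶠ x in 𝓝 z, HasDerivAt y (y₁ x) x)
    (h₂ : ∀ᶠ x in 𝓝 z, HasDerivAt y₁ (y₂ x) x) (h₃ : HasDerivAt y₂ y₃ z) :
    deriv y z = y₁ z ∧ deriv (deriv y) z = y₂ z ∧ deriv (deriv (deriv y)) z = y₃ := by
  have e₁ : deriv y =ᶠ[𝓝 z] y₁ := h₁.mono fun x hx => hx.deriv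
  have e₂ : deriv y₁ =ᶠ[𝓝 z] y₂ := h₂.mono fun x hx => hx.deriv
  have e₁₂ : deriv (deriv y) =ᶠ[𝓝 z] y₂ := e₁.deriv.trans e₂
  exact ⟨e₁.eq_of_nhds, e₁₂.eq_of_nhds, by rw [e₁₂.deriv_eq, h₃.deriv]⟩

lemma wronskian_apply (u v w : ℂ → ℂ) (z : ℂ) :
    wronskian u v w z = u z * (deriv v z * deriv (deriv w) z - deriv w z * deriv (deriv v) z)
      - v z * (deriv u z * deriv (deriv w) z - deriv w z * deriv (deriv u) z)
      + w z * (deriv u z * deriv (deriv v) z - deriv v z * deriv (deriv u) z) := by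
  simp only [wronskian, Matrix.det_fin_three, Matrix.of_apply, Matrix.cons_val', Matrix.cons_val_zero,
    Matrix.cons_val_one, Matrix.cons_val, Matrix.cons_val_fin_one]
  ring

lemma AnalyticAt.wronskian {u v w : ℂ → ℂ} {z : ℂ} (hu : AnalyticAt ℂ u z) (hv : AnalyticAt ℂ v z)
    (hw : AnalyticAt ℂ w z) : AnalyticAt ℂ (wronskian u v w) z := by
  have := hu.deriv; have := hu.deriv.deriv
  have := hv.deriv; have := hv.deriv.deriv
  have := hw.deriv; have := hw.deriv.deriv
  rw [show ThirdOrderMODE.wronskian u v w = _ from funext (wronskian_apply u v w)]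
  fun_prop

lemma hasDerivAt_wronskian {u v w : ℂ → ℂ} {z : ℂ} (hu : AnalyticAt ℂ u z) (hv : AnalyticAt ℂ v z)
    (hw : AnalyticAt ℂ w z) : HasDerivAt (wronskian u v w)
      (det3 ![u z, v z, w z] ![deriv u z, deriv v z, deriv w z]
        ![deriv (deriv (deriv u)) z, deriv (deriv (deriv v)) z, deriv (deriv (deriv w)) z]) z := by
  have u0 := hu.differentiableAt.hasDerivAt
  have u1 := hu.deriv.differentiableAt.hasDerivAt
  have u2 := hu.deriv.deriv.differentiableAt.hasDerivAt
  have v0 := hv.differentiableAt.hasDerivAt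
  have v1 := hv.deriv.differentiableAt.hasDerivAt
  have v2 := hv.deriv.deriv.differentiableAt.hasDerivAt
  have w0 := hw.differentiableAt.hasDerivAt
  have w1 := hw.deriv.differentiableAt.hasDerivAt
  have w2 := hw.deriv.deriv.differentiableAt.hasDerivAt
  rw [show ThirdOrderMODE.wronskian u v w = _ from funext (wronskian_apply u v w)]
  refine (((u0.fun_mul ((v1.fun_mul w2).fun_sub (w1.fun_mul v2))).fun_sub
    (v0.fun_mul ((u1.fun_mul w2).fun_sub (w1.fun_mul u2)))).fun_add
    (w0.fun_mul ((u1.fun_mul v2).fun_sub (v1.fun_mul u2)))).congr_deriv ?_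
  simp [det3]
  ring

lemma wronskian_mul {φ u v w : ℂ → ℂ} {z : ℂ} (hφ : AnalyticAt ℂ φ z) (hu : AnalyticAt ℂ u z)
    (hv : AnalyticAt ℂ v z) (hw : AnalyticAt ℂ w z) :
    wronskian (fun x => φ x * u x) (fun x => φ x * v x) (fun x => φ x * w x) z =
      φ z ^ 3 * wronskian u v w z := by
  have key : ∀ g : ℂ → ℂ, AnalyticAt ℂ g z → deriv (fun x => φ x * g x) z =
      deriv φ z * g z + φ z * deriv g z ∧ deriv (deriv (fun x => φ x * g x)) z =
      deriv (deriv φ) z * g z + 2 * (deriv φ z * deriv g z) + φ z * deriv (deriv g) z := by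
    intro g hg
    have h := deriv_chain (y := fun x => φ x * g x) (z := z)
      (hφ.eventually_analyticAt.and hg.eventually_analyticAt |>.mono fun x hx =>
        hx.1.differentiableAt.hasDerivAt.fun_mul hx.2.differentiableAt.hasDerivAt)
      (hφ.eventually_analyticAt.and hg.eventually_analyticAt |>.mono fun x hx =>
        (hx.1.deriv.differentiableAt.hasDerivAt.fun_mul hx.2.differentiableAt.hasDerivAt).fun_add
        (hx.1.differentiableAt.hasDerivAt.fun_mul hx.2.deriv.differentiableAt.hasDerivAt))
      (((hφ.deriv.deriv.mul hg).add (hφ.deriv.mul hg.deriv)).add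
        ((hφ.deriv.mul hg.deriv).add
          (hφ.mul hg.deriv.deriv))).differentiableAt.hasDerivAt
    refine ⟨h.1, h.2.1.trans ?_⟩
    ring
  simp only [wronskian_apply, (key u hu).1, (key u hu).2, (key v hv).1, (key v hv).2, (key w hw).1,
    (key w hw).2]
  ring

lemma wronskian_comp {γ γ' u v w : ℂ → ℂ} {z : ℂ} (hγ : ∀ᶠ x in 𝓝 z, HasDerivAt γ (γ' x) x)
    (hγ' : DifferentiableAt ℂ γ' z) (hu : AnalyticAt ℂ u (γ z)) (hv : AnalyticAt ℂ v (γ z))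
    (hw : AnalyticAt ℂ w (γ z)) :
    wronskian (fun x => u (γ x)) (fun x => v (γ x)) (fun x => w (γ x)) z =
      γ' z ^ 3 * wronskian u v w (γ z) := by
  have hc : ContinuousAt γ z := hγ.self_of_nhds.continuousAt
  have key : ∀ g : ℂ → ℂ, AnalyticAt ℂ g (γ z) → deriv (fun x => g (γ x)) z =
      deriv g (γ z) * γ' z ∧ deriv (deriv (fun x => g (γ x))) z =
      deriv (deriv g) (γ z) * γ' z * γ' z + deriv g (γ z) * deriv γ' z := by
    intro g hg
    have e : deriv (fun x => g (γ x)) =ᶠ[𝓝 z] fun x => deriv g (γ x) * γ' x := by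
      filter_upwards [hγ, hc.eventually hg.eventually_analyticAt] with x hx hx'
      exact (hx'.differentiableAt.hasDerivAt.comp x hx).deriv
    refine ⟨e.eq_of_nhds, ?_⟩
    rw [e.deriv_eq]
    exact ((hg.deriv.differentiableAt.hasDerivAt.comp z hγ.self_of_nhds).mul
      hγ'.hasDerivAt).deriv
  simp only [wronskian_apply, (key u hu).1, (key u hu).2, (key v hv).1, (key v hv).2, (key w hw).1,
    (key w hw).2]
  ring

lemma wronskian_congr {u v w u' v' w' : ℂ → ℂ} {z : ℂ} (hu : u =ᶠ[𝓝 z] u') (hv : v =ᶠ[𝓝 z] v')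
    (hw : w =ᶠ[𝓝 z] w') : wronskian u v w z = wronskian u' v' w' z := by
  simp only [wronskian_apply, hu.eq_of_nhds, hv.eq_of_nhds, hw.eq_of_nhds, hu.deriv_eq, hv.deriv_eq,
    hw.deriv_eq, hu.deriv.deriv_eq, hv.deriv.deriv_eq, hw.deriv.deriv_eq]

/-- Derivatives of a linear combination. -/
lemma deriv_lincomb {F : Fin 3 → ℂ → ℂ} {z : ℂ} (hF : ∀ j, AnalyticAt ℂ (F j) z) (a : Fin 3 → ℂ) :
    deriv (fun x => ∑ j, a j * F j x) z = ∑ j, a j * deriv (F j) z ∧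
    deriv (deriv (fun x => ∑ j, a j * F j x)) z = ∑ j, a j * deriv (deriv (F j)) z ∧
    deriv (deriv (deriv (fun x => ∑ j, a j * F j x))) z =
      ∑ j, a j * deriv (deriv (deriv (F j))) z := by
  have hF' : ∀ᶠ x in 𝓝 z, ∀ j, AnalyticAt ℂ (F j) x :=
    eventually_all.2 fun j => (hF j).eventually_analyticAt
  refine deriv_chain (y₁ := fun x => ∑ j, a j * deriv (F j) x)
    (y₂ := fun x => ∑ j, a j * deriv (deriv (F j)) x)
    (hF'.mono fun x hx => ?_) (hF'.mono fun x hx => ?_) ?_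
  · exact HasDerivAt.fun_sum fun j _ => (hx j).differentiableAt.hasDerivAt.const_mul _
  · exact HasDerivAt.fun_sum fun j _ => (hx j).deriv.differentiableAt.hasDerivAt.const_mul _
  · exact HasDerivAt.fun_sum fun j _ => (hF j).deriv.deriv.differentiableAt.hasDerivAt.const_mul _

lemma wronskian_lincomb {F : Fin 3 → ℂ → ℂ} {z : ℂ} (hF : ∀ j, AnalyticAt ℂ (F j) z)
    (a : Fin 3 → Fin 3 → ℂ) :
    wronskian (fun x => ∑ j, a 0 j * F j x) (fun x => ∑ j, a 1 j * F j x)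
      (fun x => ∑ j, a 2 j * F j x) z =
      det3 (a 0) (a 1) (a 2) * wronskian (F 0) (F 1) (F 2) z := by
  rw [wronskian_apply]
  simp only [(deriv_lincomb hF (a 0)).1, (deriv_lincomb hF (a 1)).1,
    (deriv_lincomb hF (a 2)).1, (deriv_lincomb hF (a 0)).2.1, (deriv_lincomb hF (a 1)).2.1,
    (deriv_lincomb hF (a 2)).2.1]
  simp only [wronskian_apply, Fin.sum_univ_three, det3]
  ring

/-! ### Solution spaces -/

lemma IsSolutionOn.mono {Q₂ Q₃ y : ℂ → ℂ} {S T : Set ℂ} (h : IsSolutionOn Q₂ Q₃ S y) (hTS : T ⊆ S) :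
    IsSolutionOn Q₂ Q₃ T y :=
  ⟨h.1.mono hTS, h.2.filter_mono (codiscreteWithin_mono hTS)⟩

lemma IsSolutionOn.lincomb {Q₂ Q₃ : ℂ → ℂ} {S : Set ℂ} {F : Fin 3 → ℂ → ℂ}
    (h : ∀ j, IsSolutionOn Q₂ Q₃ S (F j)) (a : Fin 3 → ℂ) :
    IsSolutionOn Q₂ Q₃ S (fun z => ∑ j, a j * F j z) := by
  refine ⟨fun z hz => ?_, ?_⟩
  · have := fun j => (h j).1 z hz
    fun_prop
  · filter_upwards [eventually_all.2 fun j => (h j).2, self_mem_codiscreteWithin S] with z hz hzS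
    have hF := fun j => (h j).1 z hzS
    rw [(deriv_lincomb hF a).1, (deriv_lincomb hF a).2.2]
    simp only [Fin.sum_univ_three]
    linear_combination a 0 * hz 0 + a 1 * hz 1 + a 2 * hz 2

/-- Abel's identity: as the equation has no term in `y''`, Wronskians of solutions are constant. -/
lemma IsSolutionOn.wronskian_const {Q₂ Q₃ u v w : ℂ → ℂ} {S : Set ℂ} (hS : IsOpen S)
    (hS' : IsPreconnected S) (hu : IsSolutionOn Q₂ Q₃ S u) (hv : IsSolutionOn Q₂ Q₃ S v)
    (hw : IsSolutionOn Q₂ Q₃ S w) : ∃ a, ∀ z ∈ S, wronskian u v w z = a := by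
  have hA : ∀ z ∈ S, AnalyticAt ℂ (wronskian u v w) z := fun z hz =>
    AnalyticAt.wronskian (hu.1 z hz) (hv.1 z hz) (hw.1 z hz)
  refine hS.exists_is_const_of_deriv_eq_zero hS'
    (fun z hz => (hA z hz).differentiableAt.differentiableWithinAt) ?_
  refine eq_zero_of_eventually_codiscreteWithin hS (fun z hz => (hA z hz).deriv.continuousAt) ?_
  filter_upwards [hu.2, hv.2, hw.2, self_mem_codiscreteWithin S] with z eu ev ew hz
  rw [(hasDerivAt_wronskian (hu.1 z hz) (hv.1 z hz) (hw.1 z hz)).deriv]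
  simp only [det3, Matrix.cons_val_zero, Matrix.cons_val_one, Matrix.cons_val]
  linear_combination (u z * deriv v z - v z * deriv u z) * ew -
    (u z * deriv w z - w z * deriv u z) * ev + (v z * deriv w z - w z * deriv v z) * eu

/-- Three solutions with nonvanishing Wronskian span the solution space. -/
lemma IsSolutionOn.exists_lincomb {Q₂ Q₃ y : ℂ → ℂ} {S : Set ℂ} (hS : IsOpen S)
    (hS' : IsPreconnected S) {F : Fin 3 → ℂ → ℂ} (hF : ∀ j, IsSolutionOn Q₂ Q₃ S (F j))
    (hW : ∀ z ∈ S, wronskian (F 0) (F 1) (F 2) z ≠ 0) (hy : IsSolutionOn Q₂ Q₃ S y) :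
    ∃ a : Fin 3 → ℂ, ∀ z ∈ S, y z = ∑ j, a j * F j z := by
  obtain ⟨d, hd⟩ := wronskian_const hS hS' (hF 0) (hF 1) (hF 2)
  obtain ⟨d₀, h₀⟩ := wronskian_const hS hS' hy (hF 1) (hF 2)
  obtain ⟨d₁, h₁⟩ := wronskian_const hS hS' (hF 0) hy (hF 2)
  obtain ⟨d₂, h₂⟩ := wronskian_const hS hS' (hF 0) (hF 1) hy
  refine ⟨![d₀ / d, d₁ / d, d₂ / d], fun z hz => ?_⟩
  have hd0 : d ≠ 0 := hd z hz ▸ hW z hz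
  -- expansion of a `4 × 4` determinant with two equal columns
  have key : y z * d = d₀ * F 0 z + d₁ * F 1 z + d₂ * F 2 z := by
    rw [← hd z hz, ← h₀ z hz, ← h₁ z hz, ← h₂ z hz]
    simp only [wronskian_apply]
    ring
  simp only [Fin.sum_univ_three, Matrix.cons_val_zero, Matrix.cons_val_one, Matrix.cons_val]
  field_simp
  exact key

/-! ### Germs of analytic functions -/

lemma exists_cube_root {X : ℂ → ℂ} {z₀ : ℂ} (hX : AnalyticAt ℂ X z₀) (h0 : X z₀ ≠ 0) :
    ∃ C : ℂ → ℂ, AnalyticAt ℂ C z₀ ∧ C z₀ ≠ 0 ∧ ∀ z, C z ^ 3 = X z := by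
  have key : ∀ z, (X z₀ ^ (((3 : ℕ) : ℂ)⁻¹) * (X z / X z₀) ^ (((3 : ℕ) : ℂ)⁻¹)) ^ 3 = X z := by
    intro z
    rw [mul_pow, cpow_nat_inv_pow _ (by norm_num), cpow_nat_inv_pow _ (by norm_num),
      mul_div_cancel₀ _ h0]
  refine ⟨fun z => X z₀ ^ (((3 : ℕ) : ℂ)⁻¹) * (X z / X z₀) ^ (((3 : ℕ) : ℂ)⁻¹), ?_, ?_, key⟩
  · refine analyticAt_const.mul ((hX.div analyticAt_const h0).cpow analyticAt_const ?_)
    simp [div_self h0]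
  · intro h
    have := key z₀
    beta_reduce at h
    rw [h] at this
    exact h0 (by rw [← this]; norm_num)

/-- Three linearly independent germs have linear combinations of three different orders. -/
lemma exists_echelon {F : Fin 3 → ℂ → ℂ} {z₀ : ℂ} (hF : ∀ j, AnalyticAt ℂ (F j) z₀)
    (hind : ∀ a : Fin 3 → ℂ, (∀ᶠ z in 𝓝 z₀, ∑ j, a j * F j z = 0) → a = 0) :
    ∃ (v : Fin 3 → Fin 3 → ℂ) (n : Fin 3 → ℕ) (U : Fin 3 → ℂ → ℂ), StrictMono n ∧
      ∀ i, AnalyticAt ℂ (U i) z₀ ∧ U i z₀ ≠ 0 ∧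
        ∀ᶠ z in 𝓝 z₀, ∑ j, v i j * F j z = (z - z₀) ^ n i * U i z := by
  set L : (Fin 3 → ℂ) → ℂ → ℂ := fun a z => ∑ j, a j * F j z with hL
  have hLa : ∀ a, AnalyticAt ℂ (L a) z₀ := fun a => by simp only [hL]; fun_prop
  let o : (Fin 3 → ℂ) → ℕ := fun a => analyticOrderNatAt (L a) z₀
  have ho : ∀ a, a ≠ 0 → analyticOrderAt (L a) z₀ = o a := fun a ha =>
    (Nat.cast_analyticOrderNatAt fun h => ha (hind a (analyticOrderAt_eq_top.1 h))).symm
  let D : ℕ → (Fin 3 → ℂ) →ₗ[ℂ] ℂ := fun n =>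
    ∑ j, iteratedDeriv n (F j) z₀ • LinearMap.proj j
  have hD : ∀ n a, iteratedDeriv n (L a) z₀ = D n a := by
    intro n a
    simp only [hL, D]
    rw [iteratedDeriv_fun_sum fun j _ => by have := (hF j).contDiffAt (n := n); fun_prop]
    simp [mul_comm]
  have ho' : ∀ a, a ≠ 0 → (∀ i < o a, D i a = 0) ∧ D (o a) a ≠ 0 := by
    intro a ha
    have := (analyticOrderAt_eq_nat_iff_iteratedDeriv_eq_zero (hLa a)).1 (ho a ha)
    simpa only [hD] using this
  have hmin : ∀ P : (Fin 3 → ℂ) → Prop, (∃ a, P a) → ∃ a, P a ∧ ∀ b, P b → o a ≤ o b := by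
    intro P hP
    obtain ⟨a, ha⟩ := hP
    obtain ⟨a, ha, hm⟩ := (measure o).wf.has_min {a | P a} ⟨a, ha⟩
    exact ⟨a, ha, fun b hb => not_lt.1 (hm b hb)⟩
  -- choose successively elements of least order, the later ones in the kernels of the leading
  -- coefficients `D (o a₀)` and `D (o a₁)` of the earlier ones
  obtain ⟨a₀, ha₀, hm₀⟩ := hmin (fun a => a ≠ 0) ⟨fun _ => 1, fun h => by simpa using congr_fun h 0⟩
  obtain ⟨b, hb, hb0⟩ := (Submodule.ne_bot_iff _).1
    (LinearMap.ker_ne_bot_of_finrank_lt (f := D (o a₀)) (by simp))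
  obtain ⟨a₁, ⟨ha₁, hk₁⟩, hm₁⟩ := hmin (fun a => a ≠ 0 ∧ D (o a₀) a = 0) ⟨b, hb0, hb⟩
  obtain ⟨a₂, hk₂, ha₂⟩ := (Submodule.ne_bot_iff _).1
    (LinearMap.ker_ne_bot_of_finrank_lt (f := (D (o a₀)).prod (D (o a₁))) (by simp))
  have hk₂' : D (o a₀) a₂ = 0 ∧ D (o a₁) a₂ = 0 := by simpa [Prod.ext_iff] using hk₂
  have h01 : o a₀ < o a₁ := lt_of_le_of_ne (hm₀ _ ha₁) fun h => (ho' a₁ ha₁).2 (h ▸ hk₁)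
  have h12 : o a₁ < o a₂ := lt_of_le_of_ne (hm₁ _ ⟨ha₂, hk₂'.1⟩) fun h =>
    (ho' a₂ ha₂).2 (h ▸ hk₂'.2)
  have hv : ∀ i, (![a₀, a₁, a₂] : Fin 3 → Fin 3 → ℂ) i ≠ 0 := by
    intro i; fin_cases i <;> assumption
  have hU : ∀ i, ∃ U : ℂ → ℂ, AnalyticAt ℂ U z₀ ∧ U z₀ ≠ 0 ∧ ∀ᶠ z in 𝓝 z₀,
      L (![a₀, a₁, a₂] i) z = (z - z₀) ^ o (![a₀, a₁, a₂] i) * U z := fun i =>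
    (hLa _).analyticOrderAt_eq_natCast.1 (ho _ (hv i))
  choose U hU using hU
  refine ⟨![a₀, a₁, a₂], fun i => o (![a₀, a₁, a₂] i), U, ?_, hU⟩
  rw [Fin.strictMono_iff_lt_succ]
  intro i
  fin_cases i
  · exact h01
  · exact h12

/-! ### Euler operators -/

/-- The Euler operator `(z - z₀) d/dz + κ`, which describes the derivative of
`(z - z₀) ^ κ * U z` in terms of `U`. -/
def euler (z₀ κ : ℂ) (U : ℂ → ℂ) : ℂ → ℂ := fun z => (z - z₀) * deriv U z + κ * U z

lemma AnalyticAt.euler {z₀ κ z : ℂ} {U : ℂ → ℂ} (hU : AnalyticAt ℂ U z) :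
    AnalyticAt ℂ (euler z₀ κ U) z := by
  have := hU.deriv
  unfold ThirdOrderMODE.euler
  fun_prop

lemma euler_self (z₀ κ : ℂ) (U : ℂ → ℂ) : euler z₀ κ U z₀ = κ * U z₀ := by simp [euler]

lemma hasDerivAt_cpow_mul {z₀ κ z : ℂ} {U : ℂ → ℂ} (hU : AnalyticAt ℂ U z)
    (hz : z - z₀ ∈ slitPlane) :
    HasDerivAt (fun x => (x - z₀) ^ κ * U x) ((z - z₀) ^ (κ - 1) * euler z₀ κ U z) z := by
  have h1 : HasDerivAt (fun x => (x - z₀) ^ κ) (κ * (z - z₀) ^ (κ - 1) * 1) z :=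
    ((hasDerivAt_id z).sub_const z₀).cpow_const hz
  refine (h1.fun_mul hU.differentiableAt.hasDerivAt).congr_deriv ?_
  have h2 : (z - z₀) ^ κ = (z - z₀) ^ (κ - 1) * (z - z₀) := by
    rw [cpow_sub _ _ (slitPlane_ne_zero hz), cpow_one, div_mul_cancel₀ _ (slitPlane_ne_zero hz)]
  rw [h2, euler]
  ring

lemma deriv_cpow_mul {z₀ κ z : ℂ} {U : ℂ → ℂ} (hU : AnalyticAt ℂ U z) (hz : z - z₀ ∈ slitPlane) :
    deriv (fun x => (x - z₀) ^ κ * U x) z = (z - z₀) ^ (κ - 1) * euler z₀ κ U z ∧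
    deriv (deriv (fun x => (x - z₀) ^ κ * U x)) z =
      (z - z₀) ^ (κ - 2) * euler z₀ (κ - 1) (euler z₀ κ U) z ∧
    deriv (deriv (deriv (fun x => (x - z₀) ^ κ * U x))) z =
      (z - z₀) ^ (κ - 3) * euler z₀ (κ - 2) (euler z₀ (κ - 1) (euler z₀ κ U)) z := by
  have hS : ∀ᶠ x in 𝓝 z, x - z₀ ∈ slitPlane :=
    (isOpen_slitPlane.preimage (continuous_id.sub continuous_const)).mem_nhds hz
  refine deriv_chain (y₂ := fun x => (x - z₀) ^ (κ - 2) * euler z₀ (κ - 1) (euler z₀ κ U) x)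
    (by filter_upwards [hS, hU.eventually_analyticAt] with x hx hx'
        using hasDerivAt_cpow_mul (κ := κ) hx' hx) ?_ ?_
  · filter_upwards [hS, hU.eventually_analyticAt] with x hx hx'
    convert! hasDerivAt_cpow_mul (κ := κ - 1) (AnalyticAt.euler hx') hx using 3
    ring
  · convert! hasDerivAt_cpow_mul (κ := κ - 2) (AnalyticAt.euler (AnalyticAt.euler hU)) hz using 3
    ring

lemma hasDerivAt_exp_mul {κ z : ℂ} {U : ℂ → ℂ} (hU : AnalyticAt ℂ U (exp (2 * Real.pi * I * z))) :
    HasDerivAt (fun x => exp (2 * Real.pi * I * κ * x) * U (exp (2 * Real.pi * I * x)))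
      (2 * Real.pi * I * (exp (2 * Real.pi * I * κ * z) *
        euler 0 κ U (exp (2 * Real.pi * I * z)))) z := by
  have h1 : ∀ c : ℂ, HasDerivAt (fun x => exp (c * x)) (exp (c * z) * (c * 1)) z := fun c =>
    ((hasDerivAt_id z).const_mul c).cexp
  refine ((h1 _).fun_mul (hU.differentiableAt.hasDerivAt.comp z (h1 _))).congr_deriv ?_
  simp only [euler, Function.comp_apply]
  ring

lemma deriv_exp_mul {κ z : ℂ} {U : ℂ → ℂ} (hU : AnalyticAt ℂ U (exp (2 * Real.pi * I * z))) :
    deriv (fun x => exp (2 * Real.pi * I * κ * x) * U (exp (2 * Real.pi * I * x))) z =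
      2 * Real.pi * I * (exp (2 * Real.pi * I * κ * z) *
        euler 0 κ U (exp (2 * Real.pi * I * z))) ∧
    deriv (deriv (fun x => exp (2 * Real.pi * I * κ * x) * U (exp (2 * Real.pi * I * x)))) z =
      (2 * Real.pi * I) ^ 2 * (exp (2 * Real.pi * I * κ * z) *
        euler 0 κ (euler 0 κ U) (exp (2 * Real.pi * I * z))) ∧
    deriv (deriv (deriv (fun x => exp (2 * Real.pi * I * κ * x) *
      U (exp (2 * Real.pi * I * x))))) z = (2 * Real.pi * I) ^ 3 * (exp (2 * Real.pi * I * κ * z) *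
        euler 0 κ (euler 0 κ (euler 0 κ U)) (exp (2 * Real.pi * I * z))) := by
  have hc : ContinuousAt (fun x => exp (2 * Real.pi * I * x)) z := by fun_prop
  have hU' : ∀ᶠ x in 𝓝 z, AnalyticAt ℂ U (exp (2 * Real.pi * I * x)) :=
    hc.eventually hU.eventually_analyticAt
  refine deriv_chain (hU'.mono fun x hx => hasDerivAt_exp_mul hx) (y₂ := fun x =>
    (2 * Real.pi * I) ^ 2 * (exp (2 * Real.pi * I * κ * x) *
        euler 0 κ (euler 0 κ U) (exp (2 * Real.pi * I * x)))) (hU'.mono fun x hx => ?_) ?_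
  · refine ((hasDerivAt_exp_mul (κ := κ) (AnalyticAt.euler hx)).const_mul
      (2 * Real.pi * I)).congr_deriv ?_
    ring
  · refine ((hasDerivAt_exp_mul (κ := κ) (AnalyticAt.euler (AnalyticAt.euler hU))).const_mul
      ((2 * Real.pi * I) ^ 2)).congr_deriv ?_
    ring

/-! ### Slit discs -/

/-- The disc of radius `r` around `z₀`, slit along `z₀ + (-∞, 0]`. -/
def slitBall (z₀ : ℂ) (r : ℝ) : Set ℂ := {z | z ∈ Metric.ball z₀ r ∧ z - z₀ ∈ slitPlane}

lemma isOpen_slitBall (z₀ : ℂ) (r : ℝ) : IsOpen (slitBall z₀ r) :=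
  Metric.isOpen_ball.inter (isOpen_slitPlane.preimage (continuous_id.sub continuous_const))

lemma add_ofReal_mem_slitBall {z₀ : ℂ} {r s : ℝ} (hs : 0 < s) (hsr : s < r) :
    z₀ + s ∈ slitBall z₀ r := by
  refine ⟨?_, ?_⟩
  · rw [Metric.mem_ball, dist_eq, add_sub_cancel_left, norm_real, Real.norm_of_nonneg hs.le]
    exact hsr
  · rw [add_sub_cancel_left]
    exact ofReal_mem_slitPlane.2 hs

lemma isPreconnected_slitBall {z₀ : ℂ} {r : ℝ} (hr : 0 < r) : IsPreconnected (slitBall z₀ r) := by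
  have hmem := add_ofReal_mem_slitBall (z₀ := z₀) (half_pos hr) (half_lt_self hr)
  have hstar : StarConvex ℝ (z₀ + (r / 2 : ℝ)) (slitBall z₀ r) := by
    intro z hz a b ha hb hab
    refine ⟨(convex_ball z₀ r) hmem.1 hz.1 ha hb hab, ?_⟩
    have := starConvex_ofReal_slitPlane (half_pos hr) hz.2 ha hb hab
    convert! this using 1
    have hab' : (a : ℂ) + b = 1 := by exact_mod_cast hab
    simp only [real_smul]
    linear_combination z₀ * hab'
  exact (hstar.isPathConnected hmem).isConnected.isPreconnected

lemma mem_closure_slitBall {z₀ : ℂ} {r : ℝ} (hr : 0 < r) : z₀ ∈ closure (slitBall z₀ r) := by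
  rw [Metric.mem_closure_iff]
  intro ε hε
  have hm : 0 < min ε r := lt_min hε hr
  refine ⟨_, add_ofReal_mem_slitBall (half_pos hm)
    ((half_lt_self hm).trans_le (min_le_right _ _)), ?_⟩
  have := (add_ofReal_mem_slitBall (z₀ := z₀) (half_pos hm)
    ((half_lt_self hm).trans_le (min_le_left _ _))).1
  rwa [dist_comm]

lemma nhdsWithin_slitBall_le (z₀ : ℂ) (r : ℝ) : 𝓝[slitBall z₀ r] z₀ ≤ 𝓝[≠] z₀ := by
  refine nhdsWithin_mono _ fun z hz h => ?_
  have h' : z = z₀ := h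
  have := slitPlane_ne_zero hz.2
  rw [h', sub_self] at this
  exact this rfl

/-! ### The equation near a point of the upper half plane -/

lemma IsEquationOf.isSolutionOn_div {F : Fin 3 → ℂ → ℂ} {Q₂ Q₃ : ℂ → ℂ}
    (hQ : IsEquationOf (F 0) (F 1) (F 2) Q₂ Q₃) {S : Set ℂ} {c : ℂ → ℂ} (hS : IsOpen S)
    (hSH : S ⊆ upperHalf) (hc : AnalyticOnNhd ℂ c S)
    (hcW : ∀ z ∈ S, c z ^ 3 = wronskian (F 0) (F 1) (F 2) z) (hc0 : ∀ z ∈ S, c z ≠ 0) (j : Fin 3) :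
    IsSolutionOn Q₂ Q₃ S (fun z => F j z / c z) := by
  have h := hQ.satisfied S c hS hSH hc hcW fun z hz => hcW z hz ▸ pow_ne_zero 3 (hc0 z hz)
  fin_cases j
  · exact h.1
  · exact h.2.1
  · exact h.2.2

/-- Dividing by a cube root of the Wronskian normalizes the Wronskian to `1`. -/
lemma wronskian_div_cube_root {F : Fin 3 → ℂ → ℂ} {c : ℂ → ℂ} {z : ℂ}
    (hF : ∀ j, AnalyticAt ℂ (F j) z) (hc : AnalyticAt ℂ c z) (hc0 : c z ≠ 0)
    (hcW : c z ^ 3 = wronskian (F 0) (F 1) (F 2) z) :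
    wronskian (fun x => F 0 x / c x) (fun x => F 1 x / c x) (fun x => F 2 x / c x) z = 1 := by
  simp only [div_eq_inv_mul]
  rw [wronskian_mul (φ := fun x => (c x)⁻¹) (hc.inv hc0) (hF 0) (hF 1) (hF 2), ← hcW, inv_pow,
    inv_mul_cancel₀ (pow_ne_zero 3 hc0)]

/-- The Wronskian of three Frobenius-type functions in terms of Euler operators. -/
lemma wronskian_cpow_mul {z₀ z : ℂ} {κ : Fin 3 → ℂ} {U : Fin 3 → ℂ → ℂ}
    (hU : ∀ j, AnalyticAt ℂ (U j) z) (hz : z - z₀ ∈ slitPlane) :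
    wronskian (fun x => (x - z₀) ^ κ 0 * U 0 x) (fun x => (x - z₀) ^ κ 1 * U 1 x)
      (fun x => (x - z₀) ^ κ 2 * U 2 x) z =
    -((z - z₀) ^ κ 0 * (z - z₀) ^ κ 1 * (z - z₀) ^ κ 2 / (z - z₀) ^ 3) *
      det3 (fun j => euler z₀ (κ j - 1) (euler z₀ (κ j) (U j)) z)
        (fun j => euler z₀ (κ j) (U j) z) (fun j => U j z) := by
  have h0 := slitPlane_ne_zero hz
  have e1 : ∀ j, (z - z₀) ^ (κ j - 1) = (z - z₀) ^ κ j / (z - z₀) := fun j => by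
    rw [cpow_sub _ _ h0, cpow_one]
  have e2 : ∀ j, (z - z₀) ^ (κ j - 2) = (z - z₀) ^ κ j / (z - z₀) ^ 2 := fun j => by
    rw [cpow_sub _ _ h0, cpow_ofNat]
  rw [wronskian_apply]
  simp only [(deriv_cpow_mul (hU 0) hz).1, (deriv_cpow_mul (hU 1) hz).1,
    (deriv_cpow_mul (hU 2) hz).1, (deriv_cpow_mul (hU 0) hz).2.1, (deriv_cpow_mul (hU 1) hz).2.1,
    (deriv_cpow_mul (hU 2) hz).2.1, e1, e2, det3]
  field_simp
  ring

/-- If the germs at `z₀` of three analytic functions are linearly independent, then their Wronskian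
does not vanish identically near `z₀`. Along the slit disc it is compared with the Wronskian of an
echelon basis, whose leading coefficient is a Vandermonde determinant of the orders. -/
lemma frequently_wronskian_ne_zero {F : Fin 3 → ℂ → ℂ} {z₀ : ℂ} (hF : ∀ j, AnalyticAt ℂ (F j) z₀)
    (hind : ∀ a : Fin 3 → ℂ, (∀ᶠ z in 𝓝 z₀, ∑ j, a j * F j z = 0) → a = 0) :
    ∃ᶠ z in 𝓝[≠] z₀, wronskian (F 0) (F 1) (F 2) z ≠ 0 := by
  obtain ⟨v, n, U, hn, hU⟩ := exists_echelon hF hind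
  have hκ : Function.Injective fun j => (n j : ℂ) := fun i j h => hn.injective (by
    have h' : (n i : ℂ) = n j := h
    exact_mod_cast h')
  have hU1 := fun j => AnalyticAt.euler (z₀ := z₀) (κ := n j) (hU j).1
  have hU2 := fun j => AnalyticAt.euler (z₀ := z₀) (κ := n j - 1) (hU1 j)
  have hD := (AnalyticAt.det3 hU2 hU1 fun j => (hU j).1).continuousAt.eventually_ne
    (y := 0) (by
      have := det3_vandermonde_ne_zero hκ (fun j => (hU j).2.1) 1
      simp only [euler_self]
      convert! this using 3
      ring)
  have hev : ∀ᶠ z in 𝓝 z₀, z - z₀ ∈ slitPlane → wronskian (F 0) (F 1) (F 2) z ≠ 0 := by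
    filter_upwards [hD, eventually_all.2 fun j => (hU j).1.eventually_analyticAt,
      eventually_all.2 fun j => (hF j).eventually_analyticAt,
      eventually_all.2 fun j => (hU j).2.2.eventually_nhds] with z hz hUz hFz hGz hs hW
    have hS : ∀ᶠ x in 𝓝 z, x - z₀ ∈ slitPlane :=
      (isOpen_slitPlane.preimage (continuous_id.sub continuous_const)).mem_nhds hs
    have hG : ∀ i, (fun x => ∑ j, v i j * F j x) =ᶠ[𝓝 z] fun x => (x - z₀) ^ (n i : ℂ) * U i x := by
      intro i
      filter_upwards [hGz i] with x hx
      rw [hx, cpow_natCast]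
    have h1 := wronskian_lincomb hFz v
    rw [wronskian_congr (hG 0) (hG 1) (hG 2), hW, mul_zero,
      wronskian_cpow_mul (κ := fun i => (n i : ℂ)) hUz hs] at h1
    have h0 := slitPlane_ne_zero hs
    have hp : ∀ j, (z - z₀) ^ (n j : ℂ) ≠ 0 := fun j => by
      rw [cpow_natCast]; exact pow_ne_zero _ h0
    exact mul_ne_zero (neg_ne_zero.2 (div_ne_zero (mul_ne_zero (mul_ne_zero (hp 0) (hp 1)) (hp 2))
      (pow_ne_zero 3 h0))) hz h1
  obtain ⟨r, hr, hball⟩ := Metric.eventually_nhds_iff_ball.1 hev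
  have : ∃ᶠ z in 𝓝[slitBall z₀ r] z₀, wronskian (F 0) (F 1) (F 2) z ≠ 0 := by
    have hne : (𝓝[slitBall z₀ r] z₀).NeBot := mem_closure_iff_nhdsWithin_neBot.1
      (mem_closure_slitBall hr)
    exact (eventually_mem_nhdsWithin.mono fun z hz => hball z hz.1 hz.2).frequently
  exact this.filter_mono (nhdsWithin_slitBall_le z₀ r)

/-- A Wronskian that does not vanish identically is a power times a cube. -/
lemma exists_wronskian_eq_pow_mul_cube {W : ℂ → ℂ} {z₀ : ℂ} (hW : AnalyticAt ℂ W z₀)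
    (h : ∃ᶠ z in 𝓝[≠] z₀, W z ≠ 0) :
    ∃ (w : ℕ) (C : ℂ → ℂ), AnalyticAt ℂ C z₀ ∧ C z₀ ≠ 0 ∧
      ∀ᶠ z in 𝓝 z₀, W z = (z - z₀) ^ w * C z ^ 3 := by
  have htop : analyticOrderAt W z₀ ≠ ⊤ := fun ht =>
    h ((analyticOrderAt_eq_top.1 ht).filter_mono nhdsWithin_le_nhds |>.mono fun z hz => by simpa)
  obtain ⟨X, hX, hX0, hWX⟩ := hW.analyticOrderAt_ne_top.1 htop
  obtain ⟨C, hC, hC0, hCX⟩ := exists_cube_root hX hX0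
  exact ⟨analyticOrderNatAt W z₀, C, hC, hC0, hWX.mono fun z hz => by rw [hCX]; exact hz⟩

/-- The principal power gives a cube root of `x ^ w * C ^ 3`, analytic in `x` on the slit plane. -/
lemma cpow_third_mul_pow_three (x C : ℂ) (w : ℕ) :
    (x ^ ((w : ℂ) / 3) * C) ^ 3 = x ^ w * C ^ 3 := by
  rw [mul_pow, ← cpow_nat_mul, ← cpow_natCast x w]
  congr 2
  push_cast
  ring

/-- A disc around `z₀` on which `F` is analytic, with a branch of the cube root of the Wronskian on
the slit disc. -/
lemma exists_branch {F : Fin 3 → ℂ → ℂ} {z₀ : ℂ} {w : ℕ} {C : ℂ → ℂ} {P : ℂ → Prop}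
    (hz₀ : z₀ ∈ upperHalf) (hF : ∀ j, AnalyticAt ℂ (F j) z₀) (hC : AnalyticAt ℂ C z₀)
    (hC0 : C z₀ ≠ 0)
    (hW : ∀ᶠ z in 𝓝 z₀, wronskian (F 0) (F 1) (F 2) z = (z - z₀) ^ w * C z ^ 3)
    (hP : ∀ᶠ z in 𝓝 z₀, P z) :
    ∃ r > 0, ∀ z ∈ Metric.ball z₀ r, z ∈ upperHalf ∧ (∀ j, AnalyticAt ℂ (F j) z) ∧
      C z ≠ 0 ∧ P z ∧ (z - z₀ ∈ slitPlane →
        AnalyticAt ℂ (fun x => (x - z₀) ^ ((w : ℂ) / 3) * C x) z ∧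
        (z - z₀) ^ ((w : ℂ) / 3) * C z ≠ 0 ∧
        ((z - z₀) ^ ((w : ℂ) / 3) * C z) ^ 3 = wronskian (F 0) (F 1) (F 2) z) := by
  apply Metric.eventually_nhds_iff_ball.1
  filter_upwards [isOpen_upperHalf.mem_nhds hz₀, hC.eventually_analyticAt,
    eventually_all.2 fun j => (hF j).eventually_analyticAt, hC.continuousAt.eventually_ne hC0, hW,
    hP] with z h1 h2 h3 h4 h5 h6
  refine ⟨h1, h3, h4, h6, fun hs => ⟨?_, ?_, ?_⟩⟩
  · exact ((analyticAt_id.sub analyticAt_const).cpow analyticAt_const hs).mul h2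
  · exact mul_ne_zero (by rw [cpow_ne_zero_iff]; exact Or.inl (slitPlane_ne_zero hs)) h4
  · rw [cpow_third_mul_pow_three, h5]

/-- The equation near `z₀`, computed from an echelon basis `(z - z₀) ^ n i * U i`, whose quotients
by the cube root of the Wronskian are the Frobenius solutions with exponents `n i - w / 3`. The
functions `b₁`, `b₀` depend only on `F`; hence the germs of the coefficients are determined. -/
theorem exists_local_coefficients {F : Fin 3 → ℂ → ℂ} {z₀ : ℂ} (hz₀ : z₀ ∈ upperHalf)
    (hF : ∀ j, AnalyticAt ℂ (F j) z₀)
    (hind : ∀ a : Fin 3 → ℂ, (∀ᶠ z in 𝓝 z₀, ∑ j, a j * F j z = 0) → a = 0) :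
    ∃ (v : Fin 3 → Fin 3 → ℂ) (n : Fin 3 → ℕ) (U : Fin 3 → ℂ → ℂ) (w : ℕ) (b₁ b₀ : ℂ → ℂ),
      StrictMono n ∧ (∀ i, AnalyticAt ℂ (U i) z₀ ∧ U i z₀ ≠ 0 ∧
        ∀ᶠ z in 𝓝 z₀, ∑ j, v i j * F j z = (z - z₀) ^ n i * U i z) ∧
      AnalyticAt ℂ b₁ z₀ ∧ AnalyticAt ℂ b₀ z₀ ∧
      ∀ Q₂ Q₃ : ℂ → ℂ, IsEquationOf (F 0) (F 1) (F 2) Q₂ Q₃ →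
        (∀ᶠ z in 𝓝[≠] z₀, (z - z₀) ^ 2 * Q₂ z = b₁ z ∧ (z - z₀) ^ 3 * Q₃ z = b₀ z) ∧
        (Polynomial.X * (Polynomial.X - 1) * (Polynomial.X - 2) +
            Polynomial.C (b₁ z₀) * Polynomial.X + Polynomial.C (b₀ z₀) : ℂ[X]) =
          ∏ j : Fin 3, (Polynomial.X - Polynomial.C ((n j : ℂ) - w / 3)) ∧
        n 0 + n 1 + n 2 = w + 3 := by
  obtain ⟨v, n, U, hn, hU⟩ := exists_echelon hF hind
  obtain ⟨w, C, hC, hC0, hW⟩ := exists_wronskian_eq_pow_mul_cube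
    (AnalyticAt.wronskian (hF 0) (hF 1) (hF 2)) (frequently_wronskian_ne_zero hF hind)
  set κ : Fin 3 → ℂ := fun j => (n j : ℂ) - w / 3 with hκdef
  have hκ : Function.Injective κ := fun i j h => hn.injective (by
    have := sub_left_injective h
    exact_mod_cast this)
  set V : Fin 3 → ℂ → ℂ := fun j z => U j z / C z with hVdef
  have hV : ∀ j, AnalyticAt ℂ (V j) z₀ := fun j => (hU j).1.div hC hC0
  have hV0 : ∀ j, V j z₀ ≠ 0 := fun j => div_ne_zero (hU j).2.1 hC0
  have hV1 := fun j => AnalyticAt.euler (z₀ := z₀) (κ := κ j) (hV j)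
  have hV2 := fun j => AnalyticAt.euler (z₀ := z₀) (κ := κ j - 1) (hV1 j)
  have hV3 := fun j => AnalyticAt.euler (z₀ := z₀) (κ := κ j - 2) (hV2 j)
  obtain ⟨b₂, b₁, b₀, hb₂, hb₁, hb₀, hb⟩ := exists_analytic_solution hV3 hV2 hV1 hV (by
      have := det3_vandermonde_ne_zero hκ hV0 1
      simp only [euler_self]
      convert! this using 3
      ring)
  refine ⟨v, n, U, w, b₁, b₀, hn, hU, hb₁, hb₀, fun Q₂ Q₃ hQ => ?_⟩
  obtain ⟨r, hr, hball⟩ := exists_branch hz₀ hF hC hC0 hW (hb.and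
    ((eventually_all.2 fun j => (hV j).eventually_analyticAt).and
      (eventually_all.2 fun i => (hU i).2.2)))
  have hsol : ∀ i, IsSolutionOn Q₂ Q₃ (slitBall z₀ r)
      (fun z => ∑ j, v i j * (F j z / ((z - z₀) ^ ((w : ℂ) / 3) * C z))) := fun i =>
    IsSolutionOn.lincomb (hQ.isSolutionOn_div (isOpen_slitBall z₀ r) (fun z hz => (hball z hz.1).1)
      (fun z hz => ((hball z hz.1).2.2.2.2 hz.2).1) (fun z hz => ((hball z hz.1).2.2.2.2 hz.2).2.2)
      (fun z hz => ((hball z hz.1).2.2.2.2 hz.2).2.1)) (v i)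
  have heq : ∀ i, ∀ z ∈ slitBall z₀ r, ∑ j, v i j * (F j z / ((z - z₀) ^ ((w : ℂ) / 3) * C z)) =
      (z - z₀) ^ κ i * V i z := by
    intro i z hz
    obtain ⟨-, -, hCz, ⟨-, -, hG⟩, hs⟩ := hball z hz.1
    have h0 := slitPlane_ne_zero hz.2
    have hw0 : (z - z₀) ^ ((w : ℂ) / 3) ≠ 0 := left_ne_zero_of_mul (hs hz.2).2.1
    simp only [← mul_div_assoc, ← Finset.sum_div]
    rw [hG i, hκdef, hVdef]
    beta_reduce
    rw [cpow_sub _ _ h0, cpow_natCast]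
    field_simp
  -- the coefficients solve the linear system on a codiscrete subset of the slit disc
  have hsys : ∀ᶠ z in codiscreteWithin (slitBall z₀ r),
      0 = b₂ z ∧ (z - z₀) ^ 2 * Q₂ z = b₁ z ∧ (z - z₀) ^ 3 * Q₃ z = b₀ z := by
    filter_upwards [eventually_all.2 fun i => (hsol i).2, self_mem_codiscreteWithin _]
      with z hz hzS
    obtain ⟨-, -, hCz, ⟨hbz, hVz, hG⟩, hs⟩ := hball z hzS.1
    have h0 := slitPlane_ne_zero hzS.2
    refine (hbz _ _ _).1 fun i => ?_
    have he : (fun z => ∑ j, v i j * (F j z / ((z - z₀) ^ ((w : ℂ) / 3) * C z))) =ᶠ[𝓝 z]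
        fun z => (z - z₀) ^ κ i * V i z :=
      eventually_of_mem ((isOpen_slitBall z₀ r).mem_nhds hzS) (heq i)
    have h1 := hz i
    rw [he.eq_of_nhds, he.deriv_eq, he.deriv.deriv.deriv_eq, (deriv_cpow_mul (hVz i) hzS.2).1,
      (deriv_cpow_mul (hVz i) hzS.2).2.2, cpow_sub (κ i) 3 h0, cpow_sub (κ i) 1 h0, cpow_one,
      cpow_ofNat] at h1
    have hp : (z - z₀) ^ κ i ≠ 0 := by rw [cpow_ne_zero_iff]; exact Or.inl h0
    field_simp at h1
    apply mul_left_cancel₀ hp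
    linear_combination h1
  have hfreq := (frequently_of_eventually_codiscreteWithin (isOpen_slitBall z₀ r) hsys
    (mem_closure_slitBall hr)).filter_mono (nhdsWithin_slitBall_le z₀ r)
  have hm : AnalyticAt ℂ (fun z => z - z₀) z₀ := by fun_prop
  -- the identities propagate from the slit disc to a punctured neighbourhood of `z₀`
  have e₂ : ∀ᶠ z in 𝓝 z₀, 0 = b₂ z := (analyticAt_const.frequently_eq_iff_eventually_eq hb₂).1
    (hfreq.mono fun z hz => hz.1)
  have e₁ := ((((hm.pow 2).meromorphicAt.mul (hQ.meromorphic₂ z₀ hz₀))).frequently_eq_iff_eventuallyEq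
    hb₁.meromorphicAt).1 (hfreq.mono fun z hz => hz.2.1)
  have e₀ := ((((hm.pow 3).meromorphicAt.mul (hQ.meromorphic₃ z₀ hz₀))).frequently_eq_iff_eventuallyEq
    hb₀.meromorphicAt).1 (hfreq.mono fun z hz => hz.2.2)
  -- at `z₀` the system reduces to the indicial equation
  have hroots := (hb.self_of_nhds _ _ _).2 ⟨e₂.self_of_nhds, rfl, rfl⟩
  obtain ⟨hpoly, hsum⟩ := cubic_eq_prod hκ (a := -3) (b := 2 + b₁ z₀) (c := b₀ z₀)
    (p := Polynomial.X * (Polynomial.X - 1) * (Polynomial.X - 2) +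
            Polynomial.C (b₁ z₀) * Polynomial.X + Polynomial.C (b₀ z₀))
    (by simp only [map_add, map_neg, map_ofNat]; ring) (fun j => by
      apply mul_right_cancel₀ (hV0 j)
      have := hroots j
      simp only [euler_self] at this
      linear_combination this)
  refine ⟨e₁.and e₀, hpoly, ?_⟩
  have : (n 0 + n 1 + n 2 : ℂ) = w + 3 := by
    simp only [hκdef] at hsum
    linear_combination hsum
  exact_mod_cast this

/-- No solution has a logarithm at a point of the upper half plane, since the solution space is
spanned by quotients of analytic functions by `(z - z₀) ^ (w / 3)`. -/
theorem isApparentAt {F : Fin 3 → ℂ → ℂ} {z₀ : ℂ} (hz₀ : z₀ ∈ upperHalf)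
    (hF : ∀ j, AnalyticAt ℂ (F j) z₀)
    (hind : ∀ a : Fin 3 → ℂ, (∀ᶠ z in 𝓝 z₀, ∑ j, a j * F j z = 0) → a = 0) {Q₂ Q₃ : ℂ → ℂ}
    (hQ : IsEquationOf (F 0) (F 1) (F 2) Q₂ Q₃) : IsApparentAt Q₂ Q₃ z₀ := by
  intro R y hR _ hy
  obtain ⟨w, C, hC, hC0, hW⟩ := exists_wronskian_eq_pow_mul_cube
    (AnalyticAt.wronskian (hF 0) (hF 1) (hF 2)) (frequently_wronskian_ne_zero hF hind)
  obtain ⟨r, hr, hball⟩ := exists_branch hz₀ hF hC hC0 hW (Metric.ball_mem_nhds z₀ hR)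
  have hsol := hQ.isSolutionOn_div (isOpen_slitBall z₀ r) (fun z hz => (hball z hz.1).1)
      (fun z hz => ((hball z hz.1).2.2.2.2 hz.2).1) (fun z hz => ((hball z hz.1).2.2.2.2 hz.2).2.2)
      (fun z hz => ((hball z hz.1).2.2.2.2 hz.2).2.1)
  obtain ⟨a, ha⟩ := IsSolutionOn.exists_lincomb (isOpen_slitBall z₀ r) (isPreconnected_slitBall hr)
    hsol (fun z hz => by
      obtain ⟨h1, h2, h3⟩ := (hball z hz.1).2.2.2.2 hz.2
      rw [wronskian_div_cube_root (hball z hz.1).2.1 h1 h2 h3]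
      exact one_ne_zero)
    (hy.mono fun z hz => ⟨(hball z hz.1).2.2.2.1, hz.2⟩)
  refine ⟨3, fun _ => -((w : ℂ) / 3), fun j z => a j * F j z / C z,
    fun j => (analyticAt_const.mul (hF j)).div hC hC0, ?_⟩
  filter_upwards [self_mem_nhdsWithin, nhdsWithin_le_nhds (Metric.ball_mem_nhds z₀ hr)] with z hs hz
  rw [ha z ⟨hz, hs⟩]
  refine Finset.sum_congr rfl fun j _ => ?_
  rw [cpow_neg]
  have h1 := left_ne_zero_of_mul ((hball z hz).2.2.2.2 hs).2.1
  have h2 := (hball z hz).2.2.1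
  field_simp

/-! ### The equation near the cusp -/

lemma isOpen_halfPlane (Y : ℝ) : IsOpen {z : ℂ | Y < z.im} :=
  isOpen_lt continuous_const Complex.continuous_im

lemma isPreconnected_halfPlane (Y : ℝ) : IsPreconnected {z : ℂ | Y < z.im} :=
  (convex_halfSpace_im_gt Y).isPreconnected

lemma halfPlane_subset_upperHalf {Y : ℝ} (hY : 0 ≤ Y) : {z : ℂ | Y < z.im} ⊆ upperHalf :=
  fun _ hz => hY.trans_lt hz

lemma ofReal_mul_I_mem_halfPlane {Y y : ℝ} (h : Y < y) : (y : ℂ) * I ∈ {z : ℂ | Y < z.im} := by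
  simpa using h

/-- A property that holds near `q = 0` holds for `q = exp (2πiz)` on a half plane. -/
lemma exists_halfPlane {P : ℂ → Prop} (h : ∀ᶠ q in 𝓝 0, P q) :
    ∃ Y : ℝ, 0 ≤ Y ∧ ∀ z : ℂ, Y < z.im → P (exp (2 * Real.pi * I * z)) := by
  obtain ⟨r, hr, hball⟩ := Metric.eventually_nhds_iff_ball.1 h
  refine ⟨max 0 (-Real.log r / (2 * Real.pi)), le_max_left _ _, fun z hz => hball _ ?_⟩
  have hz' : -Real.log r / (2 * Real.pi) < z.im := (le_max_right _ _).trans_lt hz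
  rw [div_lt_iff₀ (by positivity)] at hz'
  rw [mem_ball_zero_iff, norm_exp, ← Real.exp_log hr, Real.exp_lt_exp]
  have : (2 * Real.pi * I * z).re = -(z.im * (2 * Real.pi)) := by simp; ring
  rw [this]
  linarith

lemma tendsto_exp_ofReal_mul_I :
    Tendsto (fun y : ℝ => exp (2 * Real.pi * I * (y * I))) atTop (𝓝 0) := by
  have : ∀ y : ℝ, exp (2 * Real.pi * I * (y * I)) = (Real.exp (-(2 * Real.pi * y)) : ℂ) := by
    intro y
    rw [ofReal_exp]
    congr 1
    push_cast
    linear_combination (2 * Real.pi * y : ℂ) * I_sq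
  simp only [this]
  rw [← ofReal_zero]
  refine (continuous_ofReal.tendsto 0).comp (Real.tendsto_exp_neg_atTop_nhds_zero.comp ?_)
  exact tendsto_id.const_mul_atTop (by positivity)

/-- The expression for the Wronskian of the functions `Φ j (exp (2πiz))` in terms of `q`. -/
def qWronskian (Φ : Fin 3 → ℂ → ℂ) (q : ℂ) : ℂ :=
  -(2 * Real.pi * I) ^ 3 * det3 (fun j => euler 0 0 (euler 0 0 (Φ j)) q)
    (fun j => euler 0 0 (Φ j) q) (fun j => Φ j q)

lemma AnalyticAt.qWronskian {Φ : Fin 3 → ℂ → ℂ} {q : ℂ} (hΦ : ∀ j, AnalyticAt ℂ (Φ j) q) :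
    AnalyticAt ℂ (qWronskian Φ) q :=
  analyticAt_const.mul (AnalyticAt.det3 (fun j => AnalyticAt.euler (AnalyticAt.euler (hΦ j)))
    (fun j => AnalyticAt.euler (hΦ j)) hΦ)

lemma wronskian_eq_qWronskian {F Φ : Fin 3 → ℂ → ℂ} {z : ℂ}
    (hΦ : ∀ j, AnalyticAt ℂ (Φ j) (exp (2 * Real.pi * I * z)))
    (h : ∀ j, F j =ᶠ[𝓝 z] fun x => Φ j (exp (2 * Real.pi * I * x))) :
    wronskian (F 0) (F 1) (F 2) z = qWronskian Φ (exp (2 * Real.pi * I * z)) := by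
  have h' : ∀ j, F j =ᶠ[𝓝 z] fun x => exp (2 * Real.pi * I * 0 * x) *
      Φ j (exp (2 * Real.pi * I * x)) := fun j => by simpa using h j
  rw [wronskian_congr (h' 0) (h' 1) (h' 2), wronskian_apply]
  simp only [(deriv_exp_mul (κ := 0) (hΦ 0)).1, (deriv_exp_mul (κ := 0) (hΦ 1)).1,
    (deriv_exp_mul (κ := 0) (hΦ 2)).1, (deriv_exp_mul (κ := 0) (hΦ 0)).2.1,
    (deriv_exp_mul (κ := 0) (hΦ 1)).2.1, (deriv_exp_mul (κ := 0) (hΦ 2)).2.1]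
  simp only [qWronskian, det3, mul_zero, zero_mul, exp_zero, one_mul]
  ring

/-- Three functions on the upper half plane, given by analytic functions of `q = exp (2πiz)` at
`q = 0`, whose germs at every point are linearly independent. -/
structure HasIndependentQExpansions (F Φ : Fin 3 → ℂ → ℂ) : Prop where
  analytic : ∀ j, AnalyticOnNhd ℂ (F j) upperHalf
  independent : ∀ z₀ ∈ upperHalf, ∀ a : Fin 3 → ℂ, (∀ᶠ z in 𝓝 z₀, ∑ j, a j * F j z = 0) → a = 0
  analytic_infty : ∀ j, AnalyticAt ℂ (Φ j) 0
  eq_infty : ∀ j, ∀ z ∈ upperHalf, F j z = Φ j (exp (2 * Real.pi * I * z))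

namespace HasIndependentQExpansions

variable {F Φ : Fin 3 → ℂ → ℂ}

lemma eventuallyEq (hF : HasIndependentQExpansions F Φ) {z : ℂ} (hz : z ∈ upperHalf) (j : Fin 3) :
    F j =ᶠ[𝓝 z] fun x => Φ j (exp (2 * Real.pi * I * x)) :=
  eventually_of_mem (isOpen_upperHalf.mem_nhds hz) (hF.eq_infty j)

lemma independent_infty (hF : HasIndependentQExpansions F Φ) (a : Fin 3 → ℂ)
    (ha : ∀ᶠ q in 𝓝 0, ∑ j, a j * Φ j q = 0) : a = 0 := by
  obtain ⟨Y, hY, h⟩ := exists_halfPlane ha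
  have hz := ofReal_mul_I_mem_halfPlane (lt_add_one Y)
  refine hF.independent _ (halfPlane_subset_upperHalf hY hz) a ?_
  filter_upwards [(isOpen_halfPlane Y).mem_nhds hz] with z hz
  rw [← h z hz]
  exact Finset.sum_congr rfl fun j _ => by rw [hF.eq_infty j z (halfPlane_subset_upperHalf hY hz)]

lemma frequently_qWronskian_ne_zero (hF : HasIndependentQExpansions F Φ) :
    ∃ᶠ q in 𝓝[≠] 0, qWronskian Φ q ≠ 0 := by
  intro hcon
  have h0 : ∀ᶠ q in 𝓝 0, qWronskian Φ q = 0 :=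
    ((AnalyticAt.qWronskian hF.analytic_infty).frequently_zero_iff_eventually_zero).1
      (hcon.mono fun q hq => by simpa using hq).frequently
  obtain ⟨Y, hY, h⟩ := exists_halfPlane
    (h0.and (eventually_all.2 fun j => (hF.analytic_infty j).eventually_analyticAt))
  have hz := ofReal_mul_I_mem_halfPlane (lt_add_one Y)
  have hzH := halfPlane_subset_upperHalf hY hz
  refine frequently_wronskian_ne_zero (fun j => hF.analytic j _ hzH) (hF.independent _ hzH) ?_
  filter_upwards [nhdsWithin_le_nhds ((isOpen_halfPlane Y).mem_nhds hz)] with z hz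
  simp only [ne_eq, not_not]
  rw [wronskian_eq_qWronskian (h z hz).2
    (hF.eventuallyEq (halfPlane_subset_upperHalf hY hz)), (h z hz).1]

/-- A half plane on which the Wronskian has a cube root of the form `q ^ (w / 3) * C q`. -/
lemma exists_branch_infty (hF : HasIndependentQExpansions F Φ) {w : ℕ} {C : ℂ → ℂ} {P : ℂ → Prop}
    (hC : AnalyticAt ℂ C 0) (hC0 : C 0 ≠ 0)
    (hW : ∀ᶠ q in 𝓝 0, qWronskian Φ q = (q - 0) ^ w * C q ^ 3) (hP : ∀ᶠ q in 𝓝 0, P q) :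
    ∃ Y : ℝ, 0 ≤ Y ∧ ∀ z : ℂ, Y < z.im → P (exp (2 * Real.pi * I * z)) ∧
      C (exp (2 * Real.pi * I * z)) ≠ 0 ∧
      AnalyticAt ℂ (fun x => exp (2 * Real.pi * I * (w / 3) * x) * C (exp (2 * Real.pi * I * x))) z ∧
      (exp (2 * Real.pi * I * (w / 3) * z) * C (exp (2 * Real.pi * I * z))) ^ 3 =
        wronskian (F 0) (F 1) (F 2) z := by
  obtain ⟨Y, hY, h⟩ := exists_halfPlane (hP.and (hW.and (hC.eventually_analyticAt.and
    ((hC.continuousAt.eventually_ne hC0).and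
    (eventually_all.2 fun j => (hF.analytic_infty j).eventually_analyticAt)))))
  refine ⟨Y, hY, fun z hz => ?_⟩
  obtain ⟨h1, h2, h3, h4, h5⟩ := h z hz
  refine ⟨h1, h4, ?_, ?_⟩
  · have : AnalyticAt ℂ (fun x => C (exp (2 * Real.pi * I * x))) z :=
      AnalyticAt.fun_comp (g := C) (f := fun x => exp (2 * Real.pi * I * x)) h3 (by fun_prop)
    fun_prop
  · rw [wronskian_eq_qWronskian h5 (hF.eventuallyEq (halfPlane_subset_upperHalf hY hz)), h2, sub_zero,
      mul_pow, ← exp_nat_mul, ← exp_nat_mul]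
    congr 2
    push_cast
    ring

/-- The equation near the cusp, computed from an echelon basis `q ^ n i * U i` of the
`q`-expansions. The solutions are `q ^ (n i - w / 3)` times an analytic function of `q`. -/
theorem exists_coefficients (hF : HasIndependentQExpansions F Φ) :
    ∃ (n : Fin 3 → ℕ) (w : ℕ) (b₁ b₀ : ℂ → ℂ),
      StrictMono n ∧ AnalyticAt ℂ b₁ 0 ∧ AnalyticAt ℂ b₀ 0 ∧
      ∀ Q₂ Q₃ : ℂ → ℂ, IsEquationOf (F 0) (F 1) (F 2) Q₂ Q₃ →
        (∃ Y : ℝ, 0 ≤ Y ∧ ∀ᶠ z in codiscreteWithin {z : ℂ | Y < z.im},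
          Q₂ z = (2 * Real.pi * I) ^ 2 * b₁ (exp (2 * Real.pi * I * z)) ∧
          Q₃ z = (2 * Real.pi * I) ^ 3 * b₀ (exp (2 * Real.pi * I * z))) ∧
        (Polynomial.X ^ 3 + Polynomial.C (b₁ 0) * Polynomial.X + Polynomial.C (b₀ 0) : ℂ[X]) =
          ∏ j : Fin 3, (Polynomial.X - Polynomial.C ((n j : ℂ) - w / 3)) ∧
        n 0 + n 1 + n 2 = w := by
  obtain ⟨v, n, U, hn, hU⟩ := exists_echelon hF.analytic_infty hF.independent_infty
  obtain ⟨w, C, hC, hC0, hW⟩ := exists_wronskian_eq_pow_mul_cube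
    (AnalyticAt.qWronskian hF.analytic_infty) hF.frequently_qWronskian_ne_zero
  set κ : Fin 3 → ℂ := fun j => (n j : ℂ) - w / 3 with hκdef
  have hκ : Function.Injective κ := fun i j h => hn.injective (by
    have := sub_left_injective h
    exact_mod_cast this)
  set V : Fin 3 → ℂ → ℂ := fun j z => U j z / C z with hVdef
  have hV : ∀ j, AnalyticAt ℂ (V j) 0 := fun j => (hU j).1.div hC hC0
  have hV0 : ∀ j, V j 0 ≠ 0 := fun j => div_ne_zero (hU j).2.1 hC0
  have hV1 := fun j => AnalyticAt.euler (z₀ := 0) (κ := κ j) (hV j)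
  have hV2 := fun j => AnalyticAt.euler (z₀ := 0) (κ := κ j) (hV1 j)
  have hV3 := fun j => AnalyticAt.euler (z₀ := 0) (κ := κ j) (hV2 j)
  obtain ⟨b₂, b₁, b₀, hb₂, hb₁, hb₀, hb⟩ := exists_analytic_solution hV3 hV2 hV1 hV (by
      have := det3_vandermonde_ne_zero hκ hV0 0
      simp only [euler_self]
      convert! this using 3
      ring)
  refine ⟨n, w, b₁, b₀, hn, hb₁, hb₀, fun Q₂ Q₃ hQ => ?_⟩
  obtain ⟨Y, hY, hbr⟩ := hF.exists_branch_infty hC hC0 hW (hb.and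
    (hb₂.eventually_analyticAt.and ((eventually_all.2 fun j => (hV j).eventually_analyticAt).and
      (eventually_all.2 fun i => (hU i).2.2))))
  have hc0 : ∀ z : ℂ, Y < z.im →
      exp (2 * Real.pi * I * (w / 3) * z) * C (exp (2 * Real.pi * I * z)) ≠ 0 := fun z hz =>
    mul_ne_zero (exp_ne_zero _) (hbr z hz).2.1
  have hsol : ∀ i, IsSolutionOn Q₂ Q₃ {z : ℂ | Y < z.im} (fun z => ∑ j, v i j *
      (F j z / (exp (2 * Real.pi * I * (w / 3) * z) * C (exp (2 * Real.pi * I * z))))) := fun i =>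
    IsSolutionOn.lincomb (hQ.isSolutionOn_div (isOpen_halfPlane Y) (halfPlane_subset_upperHalf hY)
      (fun z hz => (hbr z hz).2.2.1) (fun z hz => (hbr z hz).2.2.2) hc0) (v i)
  have heq : ∀ i, ∀ z ∈ {z : ℂ | Y < z.im}, ∑ j, v i j *
      (F j z / (exp (2 * Real.pi * I * (w / 3) * z) * C (exp (2 * Real.pi * I * z)))) =
      exp (2 * Real.pi * I * κ i * z) * V i (exp (2 * Real.pi * I * z)) := by
    intro i z hz
    obtain ⟨⟨-, -, -, hG⟩, hCz, -, -⟩ := hbr z hz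
    have hG' : ∑ j, v i j * F j z =
        exp (2 * Real.pi * I * z) ^ n i * U i (exp (2 * Real.pi * I * z)) := by
      have hGi := hG i
      rw [sub_zero] at hGi
      rw [← hGi]
      exact Finset.sum_congr rfl fun j _ => by
        rw [hF.eq_infty j z (halfPlane_subset_upperHalf hY hz)]
    have he : exp (2 * Real.pi * I * κ i * z) =
        exp (2 * Real.pi * I * z) ^ n i / exp (2 * Real.pi * I * (w / 3) * z) := by
      rw [← exp_nat_mul, ← exp_sub]
      congr 1
      simp only [hκdef]
      ring
    simp only [← mul_div_assoc, ← Finset.sum_div]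
    rw [hG', he]
    simp only [hVdef]
    have := exp_ne_zero (2 * Real.pi * I * (w / 3) * z)
    field_simp
  have hpi : (2 * Real.pi * I : ℂ) ≠ 0 := two_pi_I_ne_zero
  -- the coefficients solve the linear system on a codiscrete subset of the half plane
  have hsys : ∀ᶠ z in codiscreteWithin {z : ℂ | Y < z.im},
      0 = b₂ (exp (2 * Real.pi * I * z)) ∧
      Q₂ z / (2 * Real.pi * I) ^ 2 = b₁ (exp (2 * Real.pi * I * z)) ∧
      Q₃ z / (2 * Real.pi * I) ^ 3 = b₀ (exp (2 * Real.pi * I * z)) := by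
    filter_upwards [eventually_all.2 fun i => (hsol i).2, self_mem_codiscreteWithin _]
      with z hz hzS
    obtain ⟨⟨hbz, -, hVz, -⟩, -, -, -⟩ := hbr z hzS
    refine (hbz _ _ _).1 fun i => ?_
    have he := eventually_of_mem ((isOpen_halfPlane Y).mem_nhds hzS) (heq i)
    have he' := EventuallyEq.deriv he
    have h1 := hz i
    rw [EventuallyEq.eq_of_nhds he, EventuallyEq.deriv_eq he, he'.deriv.deriv_eq,
      (deriv_exp_mul (hVz i)).1, (deriv_exp_mul (hVz i)).2.2] at h1
    apply mul_left_cancel₀ (pow_ne_zero 3 hpi)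
    field_simp
    apply mul_left_cancel₀ (exp_ne_zero (2 * Real.pi * I * κ i * z))
    linear_combination h1
  have hb₂0 : b₂ 0 = 0 := by
    have h1 : ∀ z ∈ {z : ℂ | Y < z.im}, b₂ (exp (2 * Real.pi * I * z)) = 0 := by
      refine eq_zero_of_eventually_codiscreteWithin (isOpen_halfPlane Y)
        (E := fun z => b₂ (exp (2 * Real.pi * I * z))) (fun z hz => ?_)
        (hsys.mono fun z hz => hz.1.symm)
      exact ContinuousAt.comp' (g := b₂) (f := fun z => exp (2 * Real.pi * I * z))
        (hbr z hz).1.2.1.continuousAt (by fun_prop)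
    refine tendsto_nhds_unique_of_eventuallyEq
      (hb₂.continuousAt.tendsto.comp tendsto_exp_ofReal_mul_I) tendsto_const_nhds ?_
    filter_upwards [eventually_gt_atTop Y] with y hy
    exact h1 _ (ofReal_mul_I_mem_halfPlane hy)
  -- at `q = 0` the system reduces to the indicial equation
  have hroots := (hb.self_of_nhds _ _ _).2 ⟨hb₂0.symm, rfl, rfl⟩
  obtain ⟨hpoly, hsum⟩ := cubic_eq_prod hκ (a := 0) (b := b₁ 0) (c := b₀ 0)
    (p := Polynomial.X ^ 3 + Polynomial.C (b₁ 0) * Polynomial.X + Polynomial.C (b₀ 0))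
    (by simp) (fun j => by
      apply mul_right_cancel₀ (hV0 j)
      have := hroots j
      simp only [euler_self] at this
      linear_combination this)
  refine ⟨⟨Y, hY, hsys.mono fun z hz => ⟨?_, ?_⟩⟩, hpoly, ?_⟩
  · rw [← hz.2.1, mul_div_cancel₀ _ (pow_ne_zero 2 hpi)]
  · rw [← hz.2.2, mul_div_cancel₀ _ (pow_ne_zero 3 hpi)]
  · have : (n 0 + n 1 + n 2 : ℂ) = w := by
      simp only [hκdef] at hsum
      linear_combination hsum
    exact_mod_cast this

/-- No solution has a logarithm at the cusp, since the solution space is spanned by quotients of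
analytic functions of `q` by `q ^ (w / 3)`. -/
theorem isApparentAtInfty (hF : HasIndependentQExpansions F Φ) {Q₂ Q₃ : ℂ → ℂ}
    (hQ : IsEquationOf (F 0) (F 1) (F 2) Q₂ Q₃) : IsApparentAtInfty Q₂ Q₃ := by
  intro Y₀ y _ hy
  obtain ⟨w, C, hC, hC0, hW⟩ := exists_wronskian_eq_pow_mul_cube
    (AnalyticAt.qWronskian hF.analytic_infty) hF.frequently_qWronskian_ne_zero
  obtain ⟨Y₁, hY₁, hbr⟩ := hF.exists_branch_infty hC hC0 hW (P := fun _ => True)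
    (Eventually.of_forall fun _ => trivial)
  set Y := max Y₀ Y₁
  have hbr' : ∀ z : ℂ, Y < z.im → _ := fun z hz => hbr z ((le_max_right _ _).trans_lt hz)
  have hYH : {z : ℂ | Y < z.im} ⊆ upperHalf :=
    halfPlane_subset_upperHalf (hY₁.trans (le_max_right _ _))
  have hc0 : ∀ z : ℂ, Y < z.im →
      exp (2 * Real.pi * I * (w / 3) * z) * C (exp (2 * Real.pi * I * z)) ≠ 0 := fun z hz =>
    mul_ne_zero (exp_ne_zero _) (hbr' z hz).2.1
  obtain ⟨a, ha⟩ := IsSolutionOn.exists_lincomb (isOpen_halfPlane Y) (isPreconnected_halfPlane Y)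
    (hQ.isSolutionOn_div (isOpen_halfPlane Y) hYH
      (fun z hz => (hbr' z hz).2.2.1) (fun z hz => (hbr' z hz).2.2.2) hc0) (fun z hz => by
      rw [wronskian_div_cube_root (fun j => hF.analytic j z (hYH hz)) (hbr' z hz).2.2.1 (hc0 z hz)
        (hbr' z hz).2.2.2]
      exact one_ne_zero)
    (hy.mono fun z hz => show Y₀ < z.im from (le_max_left _ _).trans_lt hz)
  refine ⟨3, fun _ => -((w : ℂ) / 3), fun j q => a j * Φ j q / C q,
    fun j => (analyticAt_const.mul (hF.analytic_infty j)).div hC hC0, Y, fun z hz => ?_⟩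
  rw [ha z hz]
  refine Finset.sum_congr rfl fun j _ => ?_
  have he : exp (2 * Real.pi * I * -((w : ℂ) / 3) * z) =
      (exp (2 * Real.pi * I * (w / 3) * z))⁻¹ := by
    rw [← exp_neg]
    congr 1
    ring
  rw [he, hF.eq_infty j z (hYH hz)]
  have h1 := exp_ne_zero (2 * Real.pi * I * (w / 3) * z)
  have h2 := (hbr' z hz).2.1
  field_simp

end HasIndependentQExpansions

/-! ### Existence of the equation -/

/-- The derivation `g ↦ g' - u g`: if `a' = -u a`, then `(g a)' = (g' - u g) a`. -/
def twist (u g : ℂ → ℂ) : ℂ → ℂ := fun z => deriv g z - u z * g z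

lemma AnalyticAt.twist {u g : ℂ → ℂ} {z : ℂ} (hu : AnalyticAt ℂ u z) (hg : AnalyticAt ℂ g z) :
    AnalyticAt ℂ (twist u g) z :=
  hg.deriv.sub (hu.mul hg)

lemma hasDerivAt_mul_of_twist {u g a : ℂ → ℂ} {z : ℂ} (ha : HasDerivAt a (-u z * a z) z)
    (hg : AnalyticAt ℂ g z) : HasDerivAt (fun x => g x * a x) (twist u g z * a z) z := by
  refine (hg.differentiableAt.hasDerivAt.fun_mul ha).congr_deriv ?_
  rw [twist]
  ring

lemma deriv_twist {u g : ℂ → ℂ} {z : ℂ} (hu : AnalyticAt ℂ u z) (hg : AnalyticAt ℂ g z) :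
    deriv (twist u g) z = deriv (deriv g) z - (deriv u z * g z + u z * deriv g z) :=
  (hg.deriv.differentiableAt.hasDerivAt.fun_sub
    (hu.differentiableAt.hasDerivAt.fun_mul hg.differentiableAt.hasDerivAt)).deriv

lemma twist_twist_twist {u g : ℂ → ℂ} {z : ℂ} (hu : AnalyticAt ℂ u z) (hg : AnalyticAt ℂ g z) :
    twist u (twist u (twist u g)) z = deriv (deriv (deriv g)) z - 3 * u z * deriv (deriv g) z +
      (3 * u z ^ 2 - 3 * deriv u z) * deriv g z +
      (3 * u z * deriv u z - deriv (deriv u) z - u z ^ 3) * g z := by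
  have e : deriv (twist u g) =ᶠ[𝓝 z]
      fun x => deriv (deriv g) x - (deriv u x * g x + u x * deriv g x) := by
    filter_upwards [hu.eventually_analyticAt, hg.eventually_analyticAt] with x h1 h2
    exact deriv_twist h1 h2
  have e' : deriv (deriv (twist u g)) z = deriv (deriv (deriv g)) z -
      ((deriv (deriv u) z * g z + deriv u z * deriv g z) +
        (deriv u z * deriv g z + u z * deriv (deriv g) z)) := by
    rw [e.deriv_eq]
    have u0 := hu.differentiableAt.hasDerivAt
    have u1 := hu.deriv.differentiableAt.hasDerivAt
    have g0 := hg.differentiableAt.hasDerivAt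
    have g1 := hg.deriv.differentiableAt.hasDerivAt
    have g2 := hg.deriv.deriv.differentiableAt.hasDerivAt
    exact (g2.fun_sub ((u1.fun_mul g0).fun_add (u0.fun_mul g1))).deriv
  rw [twist, deriv_twist hu (AnalyticAt.twist hu hg), e',
    show twist u (twist u g) z = deriv (twist u g) z - u z * twist u g z from rfl,
    deriv_twist hu hg, twist]
  ring

/-- By Cramer's rule the three functions `F j` satisfy `W y''' = W' y'' + d₁ y' + d₀ y`, where `W` is
the Wronskian, and conjugation by `∛W`, whose logarithmic derivative is `u = W' / (3W)`, removes the
term in `y''`. -/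
theorem exists_isEquationOf {F : Fin 3 → ℂ → ℂ} (hF : ∀ j, AnalyticOnNhd ℂ (F j) upperHalf) :
    ∃ Q₂ Q₃ : ℂ → ℂ, IsEquationOf (F 0) (F 1) (F 2) Q₂ Q₃ := by
  set W := wronskian (F 0) (F 1) (F 2) with hWdef
  let u : ℂ → ℂ := fun z => deriv W z / (3 * W z)
  let d₁ : ℂ → ℂ := fun z => det3 (F · z) (fun j => deriv (deriv (deriv (F j))) z)
    (fun j => deriv (deriv (F j)) z)
  let d₀ : ℂ → ℂ := fun z => det3 (fun j => deriv (deriv (deriv (F j))) z)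
    (fun j => deriv (F j) z) (fun j => deriv (deriv (F j)) z)
  let Q₂ : ℂ → ℂ := fun z => -d₁ z / W z - 3 * u z ^ 2 + 3 * deriv u z
  let Q₃ : ℂ → ℂ := fun z => -d₀ z / W z + u z * Q₂ z + deriv (deriv u) z - 3 * u z * deriv u z +
    u z ^ 3
  have hW : AnalyticOnNhd ℂ W upperHalf := fun z hz =>
    AnalyticAt.wronskian (hF 0 z hz) (hF 1 z hz) (hF 2 z hz)
  have hu : MeromorphicOn u upperHalf := fun z hz =>
    (hW z hz).deriv.meromorphicAt.div ((MeromorphicAt.const 3 z).mul (hW z hz).meromorphicAt)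
  have hd₁ : AnalyticOnNhd ℂ d₁ upperHalf := fun z hz => AnalyticAt.det3 (fun j => hF j z hz)
    (fun j => (hF j z hz).deriv.deriv.deriv) (fun j => (hF j z hz).deriv.deriv)
  have hd₀ : AnalyticOnNhd ℂ d₀ upperHalf := fun z hz => AnalyticAt.det3
    (fun j => (hF j z hz).deriv.deriv.deriv) (fun j => (hF j z hz).deriv)
    (fun j => (hF j z hz).deriv.deriv)
  have hQ₂ : MeromorphicOn Q₂ upperHalf := fun z hz =>
    (((hd₁ z hz).neg.meromorphicAt.div (hW z hz).meromorphicAt).sub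
      ((MeromorphicAt.const 3 z).mul ((hu z hz).pow 2))).add
      ((MeromorphicAt.const 3 z).mul (hu z hz).deriv)
  have hQ₃ : MeromorphicOn Q₃ upperHalf := fun z hz =>
    (((((hd₀ z hz).neg.meromorphicAt.div (hW z hz).meromorphicAt).add
      ((hu z hz).mul (hQ₂ z hz))).add (hu z hz).deriv.deriv).sub
      (((MeromorphicAt.const 3 z).mul (hu z hz)).mul (hu z hz).deriv)).add ((hu z hz).pow 3)
  have hsat : ∀ (U : Set ℂ) (c : ℂ → ℂ), IsOpen U → U ⊆ upperHalf → AnalyticOnNhd ℂ c U →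
      (∀ z ∈ U, c z ^ 3 = W z) → (∀ z ∈ U, W z ≠ 0) → ∀ j,
      IsSolutionOn Q₂ Q₃ U (fun z => F j z / c z) := by
    intro U c hU hUH hc hcW hW0 j
    have hc0 : ∀ z ∈ U, c z ≠ 0 := fun z hz h => hW0 z hz (by rw [← hcW z hz, h]; norm_num)
    refine ⟨fun z hz => (hF j z (hUH hz)).div (hc z hz) (hc0 z hz), ?_⟩
    filter_upwards [self_mem_codiscreteWithin U] with z hz
    have ha : ∀ x ∈ U, HasDerivAt (fun x => (c x)⁻¹) (-u x * (c x)⁻¹) x := by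
      intro x hx
      have h1 := (hc x hx).differentiableAt.hasDerivAt
      have h2 : HasDerivAt W (3 * c x ^ 2 * deriv c x) x := by
        refine (h1.fun_pow 3).congr_of_eventuallyEq ?_ |>.congr_deriv (by norm_num)
        exact eventually_of_mem (hU.mem_nhds hx) fun t ht => (hcW t ht).symm
      refine (h1.fun_inv (hc0 x hx)).congr_deriv ?_
      simp only [u]
      rw [h2.deriv, ← hcW x hx]
      have := hc0 x hx
      field_simp
    have hu' : ∀ x ∈ U, AnalyticAt ℂ u x := fun x hx =>
      (hW x (hUH hx)).deriv.div (analyticAt_const.mul (hW x (hUH hx)))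
        (mul_ne_zero (by norm_num) (hW0 x hx))
    have hF' : ∀ x ∈ U, AnalyticAt ℂ (F j) x := fun x hx => hF j x (hUH hx)
    have ht : ∀ x ∈ U, AnalyticAt ℂ (twist u (F j)) x := fun x hx =>
      AnalyticAt.twist (hu' x hx) (hF' x hx)
    have hchain := deriv_chain (y := fun x => F j x * (c x)⁻¹)
      (eventually_of_mem (hU.mem_nhds hz) fun x hx =>
        hasDerivAt_mul_of_twist (ha x hx) (hF' x hx))
      (eventually_of_mem (hU.mem_nhds hz) fun x hx =>
        hasDerivAt_mul_of_twist (ha x hx) (ht x hx))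
      (hasDerivAt_mul_of_twist (ha z hz) (AnalyticAt.twist (hu' z hz) (ht z hz)))
    simp only [div_eq_mul_inv]
    rw [hchain.1, hchain.2.2, twist_twist_twist (hu' z hz) (hF' z hz), twist]
    have hcramer : W z * deriv (deriv (deriv (F j))) z =
        deriv W z * deriv (deriv (F j)) z + d₁ z * deriv (F j) z + d₀ z * F j z := by
      have hzH := hUH hz
      rw [hWdef, (hasDerivAt_wronskian (hF 0 z hzH) (hF 1 z hzH) (hF 2 z hzH)).deriv,
        wronskian_apply]
      simp only [d₁, d₀, det3, Matrix.cons_val_zero, Matrix.cons_val_one, Matrix.cons_val]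
      fin_cases j <;> simp <;> ring
    have hu0 : deriv W z = 3 * u z * W z := by
      simp only [u]
      have := hW0 z hz
      field_simp
    have h1 : d₁ z = W z * (-Q₂ z - 3 * u z ^ 2 + 3 * deriv u z) := by
      simp only [Q₂]
      have := hW0 z hz
      field_simp
      ring
    have h0 : d₀ z = W z * (-Q₃ z + u z * Q₂ z + deriv (deriv u) z - 3 * u z * deriv u z +
        u z ^ 3) := by
      simp only [Q₃]
      have := hW0 z hz
      field_simp
      ring
    rw [hu0, h1, h0] at hcramer
    have h2 := mul_left_cancel₀ (hW0 z hz) (hcramer.trans (by ring :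
      _ = W z * (3 * u z * deriv (deriv (F j)) z +
        (-Q₂ z - 3 * u z ^ 2 + 3 * deriv u z) * deriv (F j) z +
        (-Q₃ z + u z * Q₂ z + deriv (deriv u) z - 3 * u z * deriv u z + u z ^ 3) * F j z)))
    rw [h2]
    ring
  exact ⟨Q₂, Q₃, hQ₂, hQ₃, fun U c hU hUH hc hcW hW0 =>
    ⟨hsat U c hU hUH hc hcW hW0 0, hsat U c hU hUH hc hcW hW0 1, hsat U c hU hUH hc hcW hW0 2⟩⟩

/-! ### Uniqueness of the equation -/

lemma IsEquationOf.unique {F Φ : Fin 3 → ℂ → ℂ} (hF : HasIndependentQExpansions F Φ)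
    {Q₂ Q₃ P₂ P₃ : ℂ → ℂ} (hQ : IsEquationOf (F 0) (F 1) (F 2) Q₂ Q₃)
    (hP : IsEquationOf (F 0) (F 1) (F 2) P₂ P₃) :
    ∀ᶠ z in codiscreteWithin upperHalf, Q₂ z = P₂ z ∧ Q₃ z = P₃ z := by
  refine (eventually_codiscreteWithin_iff isOpen_upperHalf).2 fun z₀ hz₀ => ?_
  obtain ⟨_, _, _, _, b₁, b₀, -, -, -, -, h⟩ := exists_local_coefficients hz₀
    (fun j => hF.analytic j z₀ hz₀) (hF.independent z₀ hz₀)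
  filter_upwards [(h Q₂ Q₃ hQ).1, (h P₂ P₃ hP).1, self_mem_nhdsWithin] with z h1 h2 h3
  have h0 : z - z₀ ≠ 0 := sub_ne_zero.2 h3
  exact ⟨mul_left_cancel₀ (pow_ne_zero 2 h0) (h1.1.trans h2.1.symm),
    mul_left_cancel₀ (pow_ne_zero 3 h0) (h1.2.trans h2.2.symm)⟩

/-! ### Möbius transformations -/

/-- The denominator `cz + d` of a Möbius transformation. -/
def den (γ : SL(2, ℤ)) (z : ℂ) : ℂ := (γ 1 0 : ℂ) * z + (γ 1 1 : ℂ)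

/-- The Möbius transformation of the plane given by `γ`. -/
def mob (γ : SL(2, ℤ)) (z : ℂ) : ℂ := ((γ 0 0 : ℂ) * z + (γ 0 1 : ℂ)) / den γ z

lemma mob_eq_coe_smul (γ : SL(2, ℤ)) (τ : ℍ) : mob γ τ = ((γ • τ : ℍ) : ℂ) := by
  rw [UpperHalfPlane.coe_specialLinearGroup_apply]
  simp [mob, den]

lemma mob_mem (γ : SL(2, ℤ)) {z : ℂ} (hz : z ∈ upperHalf) : mob γ z ∈ upperHalf := by
  have := mob_eq_coe_smul γ ⟨z, hz⟩
  rw [show mob γ z = _ from this]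
  exact (γ • (⟨z, hz⟩ : ℍ)).im_pos

lemma mob_inv_mob (γ : SL(2, ℤ)) {z : ℂ} (hz : z ∈ upperHalf) : mob γ⁻¹ (mob γ z) = z := by
  have := mob_eq_coe_smul γ ⟨z, hz⟩
  rw [show mob γ z = _ from this, mob_eq_coe_smul, inv_smul_smul]

lemma mob_mob_inv (γ : SL(2, ℤ)) {z : ℂ} (hz : z ∈ upperHalf) : mob γ (mob γ⁻¹ z) = z := by
  simpa using mob_inv_mob γ⁻¹ hz

lemma den_ne_zero (γ : SL(2, ℤ)) {z : ℂ} (hz : z ∈ upperHalf) : den γ z ≠ 0 := by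
  intro h
  have := mob_mem γ hz
  rw [mob, h, div_zero] at this
  simp [upperHalf] at this

lemma hasDerivAt_den (γ : SL(2, ℤ)) (z : ℂ) : HasDerivAt (den γ) (γ 1 0 : ℂ) z := by
  refine (((hasDerivAt_id z).const_mul (γ 1 0 : ℂ)).add_const (γ 1 1 : ℂ)).congr_deriv ?_
  rw [mul_one]

lemma hasDerivAt_den_zpow (γ : SL(2, ℤ)) {z : ℂ} (hz : z ∈ upperHalf) (m : ℤ) :
    HasDerivAt (fun x => den γ x ^ m) (m * den γ z ^ (m - 1) * (γ 1 0 : ℂ)) z :=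
  (hasDerivAt_zpow m _ (Or.inl (den_ne_zero γ hz))).comp z (hasDerivAt_den γ z)

lemma hasDerivAt_mob (γ : SL(2, ℤ)) {z : ℂ} (hz : z ∈ upperHalf) :
    HasDerivAt (mob γ) (den γ z ^ (-2 : ℤ)) z := by
  have h1 : HasDerivAt (fun x => (γ 0 0 : ℂ) * x + (γ 0 1 : ℂ)) (γ 0 0 : ℂ) z := by
    refine (((hasDerivAt_id z).const_mul (γ 0 0 : ℂ)).add_const (γ 0 1 : ℂ)).congr_deriv ?_
    rw [mul_one]
  have hdet : (γ 0 0 : ℂ) * (γ 1 1 : ℂ) - (γ 0 1 : ℂ) * (γ 1 0 : ℂ) = 1 := by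
    have := γ.det_coe
    rw [Matrix.det_fin_two] at this
    exact_mod_cast this
  refine (h1.fun_div (hasDerivAt_den γ z) (den_ne_zero γ hz)).congr_deriv ?_
  rw [zpow_neg, zpow_ofNat, ← one_div]
  congr 1
  rw [← hdet, den]
  ring

lemma analyticAt_den (γ : SL(2, ℤ)) (z : ℂ) : AnalyticAt ℂ (den γ) z := by
  unfold den
  fun_prop

lemma analyticAt_mob (γ : SL(2, ℤ)) {z : ℂ} (hz : z ∈ upperHalf) : AnalyticAt ℂ (mob γ) z := by
  have : AnalyticAt ℂ (fun x => (γ 0 0 : ℂ) * x + (γ 0 1 : ℂ)) z := by fun_prop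
  exact this.div (analyticAt_den γ z) (den_ne_zero γ hz)

lemma tendsto_mob_nhdsNE (γ : SL(2, ℤ)) {z : ℂ} (hz : z ∈ upperHalf) :
    Tendsto (mob γ) (𝓝[≠] z) (𝓝[≠] (mob γ z)) :=
  (hasDerivAt_mob γ hz).tendsto_nhdsNE (zpow_ne_zero _ (den_ne_zero γ hz))

/-- Bol's lemma: the third derivative intertwines the actions of weight `-2` and weight `4`. -/
lemma deriv_bol (γ : SL(2, ℤ)) {y : ℂ → ℂ} {z : ℂ} (hz : z ∈ upperHalf)
    (hy : AnalyticAt ℂ y (mob γ z)) :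
    deriv (fun x => den γ x ^ 2 * y (mob γ x)) z =
      2 * (γ 1 0 : ℂ) * den γ z * y (mob γ z) + deriv y (mob γ z) ∧
    deriv (deriv (deriv (fun x => den γ x ^ 2 * y (mob γ x)))) z =
      deriv (deriv (deriv y)) (mob γ z) / den γ z ^ 4 := by
  have hH : ∀ᶠ x in 𝓝 z, x ∈ upperHalf := isOpen_upperHalf.mem_nhds hz
  have hy' : ∀ᶠ x in 𝓝 z, AnalyticAt ℂ y (mob γ x) :=
    (analyticAt_mob γ hz).continuousAt.eventually hy.eventually_analyticAt
  have hcomp : ∀ {g : ℂ → ℂ} {x : ℂ}, x ∈ upperHalf → AnalyticAt ℂ g (mob γ x) →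
      HasDerivAt (fun x => g (mob γ x)) (deriv g (mob γ x) * den γ x ^ (-2 : ℤ)) x :=
    fun hx hg => hg.differentiableAt.hasDerivAt.comp _ (hasDerivAt_mob γ hx)
  have h := deriv_chain (y := fun x => den γ x ^ 2 * y (mob γ x)) (z := z)
    (y₁ := fun x => 2 * (γ 1 0 : ℂ) * den γ x * y (mob γ x) + deriv y (mob γ x))
    (y₂ := fun x => 2 * (γ 1 0 : ℂ) ^ 2 * y (mob γ x) +
      2 * (γ 1 0 : ℂ) * den γ x ^ (-1 : ℤ) * deriv y (mob γ x) +
      den γ x ^ (-2 : ℤ) * deriv (deriv y) (mob γ x))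
    (y₃ := deriv (deriv (deriv y)) (mob γ z) / den γ z ^ 4) ?_ ?_ ?_
  · exact ⟨h.1, h.2.2⟩
  · filter_upwards [hH, hy'] with x hx hyx
    have h0 := den_ne_zero γ hx
    refine (((hasDerivAt_den γ x).fun_pow 2).fun_mul (hcomp hx hyx)).congr_deriv ?_
    simp only [zpow_neg, zpow_ofNat, Nat.cast_ofNat]
    field_simp
    ring
  · filter_upwards [hH, hy'] with x hx hyx
    have h0 := den_ne_zero γ hx
    refine ((((hasDerivAt_den γ x).const_mul (2 * (γ 1 0 : ℂ))).fun_mul (hcomp hx hyx)).fun_add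
      (hcomp hx hyx.deriv)).congr_deriv ?_
    simp only [zpow_neg, zpow_ofNat]
    field_simp
  · have h0 := den_ne_zero γ hz
    refine (((hcomp hz hy).const_mul (2 * (γ 1 0 : ℂ) ^ 2)).fun_add
      (((hasDerivAt_den_zpow γ hz (-1)).const_mul (2 * (γ 1 0 : ℂ))).fun_mul
        (hcomp hz hy.deriv)) |>.fun_add ((hasDerivAt_den_zpow γ hz (-2)).fun_mul
        (hcomp hz hy.deriv.deriv))).congr_deriv ?_
    rw [show (-1 - 1 : ℤ) = -2 by norm_num, show (-2 - 1 : ℤ) = -3 by norm_num]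
    simp only [zpow_neg, zpow_ofNat]
    push_cast
    field_simp
    ring

/-! ### Modularity of the equation -/

/-- Modularity of weight `k` of a family of functions of a complex variable. -/
def IsModularFamily (k : ℤ) (F : Fin 3 → ℂ → ℂ) : Prop :=
  ∀ (j : Fin 3) (γ : SL(2, ℤ)), ∀ z ∈ upperHalf, F j (mob γ z) = den γ z ^ k * F j z

lemma wronskian_mob {k : ℤ} {F : Fin 3 → ℂ → ℂ} (hF : ∀ j, AnalyticOnNhd ℂ (F j) upperHalf)
    (hmod : IsModularFamily k F) (γ : SL(2, ℤ)) {z : ℂ} (hz : z ∈ upperHalf) :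
    wronskian (F 0) (F 1) (F 2) (mob γ z) =
      (den γ z ^ (k + 2)) ^ 3 * wronskian (F 0) (F 1) (F 2) z := by
  have hH : ∀ᶠ x in 𝓝 z, x ∈ upperHalf := isOpen_upperHalf.mem_nhds hz
  have h0 := den_ne_zero γ hz
  have h1 := wronskian_comp (hH.mono fun x hx => hasDerivAt_mob γ hx)
    (hasDerivAt_den_zpow γ hz (-2)).differentiableAt (hF 0 _ (mob_mem γ hz))
    (hF 1 _ (mob_mem γ hz)) (hF 2 _ (mob_mem γ hz))
  have h2 := wronskian_mul (φ := fun x => den γ x ^ k) ((analyticAt_den γ z).zpow h0)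
    (hF 0 z hz) (hF 1 z hz) (hF 2 z hz)
  have he : ∀ j, (fun x => F j (mob γ x)) =ᶠ[𝓝 z] fun x => den γ x ^ k * F j x := fun j =>
    hH.mono fun x hx => hmod j γ x hx
  rw [wronskian_congr (he 0) (he 1) (he 2), h2] at h1
  rw [zpow_add₀ h0, mul_pow, mul_comm ((den γ z ^ k) ^ 3), mul_assoc, h1]
  simp only [zpow_neg, zpow_ofNat]
  field_simp

/-- The pullback of the equation by a modular transformation is an equation for the same functions,
since the action of weight `-2` preserves their quotients by `∛W` up to the choice of the branch. -/
lemma IsEquationOf.pullback {k : ℤ} {F : Fin 3 → ℂ → ℂ} (hF : ∀ j, AnalyticOnNhd ℂ (F j) upperHalf)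
    (hmod : IsModularFamily k F) {Q₂ Q₃ : ℂ → ℂ} (hQ : IsEquationOf (F 0) (F 1) (F 2) Q₂ Q₃)
    (γ : SL(2, ℤ)) : IsEquationOf (F 0) (F 1) (F 2) (fun z => Q₂ (mob γ z) / den γ z ^ 4)
      (fun z => Q₃ (mob γ z) / den γ z ^ 6 - 2 * (γ 1 0 : ℂ) * Q₂ (mob γ z) / den γ z ^ 5) := by
  have hm₂ : ∀ z ∈ upperHalf, MeromorphicAt (fun z => Q₂ (mob γ z)) z := fun z hz =>
    (hQ.meromorphic₂ _ (mob_mem γ hz)).comp_analyticAt (analyticAt_mob γ hz)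
  have hm₃ : ∀ z ∈ upperHalf, MeromorphicAt (fun z => Q₃ (mob γ z)) z := fun z hz =>
    (hQ.meromorphic₃ _ (mob_mem γ hz)).comp_analyticAt (analyticAt_mob γ hz)
  have hd := fun z => (analyticAt_den γ z).meromorphicAt
  refine ⟨fun z hz => (hm₂ z hz).div ((hd z).pow 4),
    fun z hz => ((hm₃ z hz).div ((hd z).pow 6)).sub
      (((MeromorphicAt.const _ z).mul (hm₂ z hz)).div ((hd z).pow 5)), ?_⟩
  intro U c hU hUH hc hcW hW0
  have hc0 : ∀ z ∈ U, c z ≠ 0 := fun z hz h => hW0 z hz (by rw [← hcW z hz, h]; norm_num)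
  have hU' : IsOpen (upperHalf ∩ mob γ⁻¹ ⁻¹' U) :=
    ContinuousOn.isOpen_inter_preimage
      (fun z hz => (analyticAt_mob γ⁻¹ hz).continuousAt.continuousWithinAt) isOpen_upperHalf hU
  have hsol := hQ.isSolutionOn_div hU' Set.inter_subset_left
    (c := fun w => c (mob γ⁻¹ w) * den γ (mob γ⁻¹ w) ^ (k + 2))
    (fun w hw => ((hc _ hw.2).comp (analyticAt_mob γ⁻¹ hw.1)).mul
      (((analyticAt_den γ _).comp (analyticAt_mob γ⁻¹ hw.1)).zpow
        (den_ne_zero γ (hUH hw.2))))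
    (fun w hw => by
      rw [mul_pow, hcW _ hw.2, mul_comm, ← wronskian_mob hF hmod γ (hUH hw.2), mob_mob_inv γ hw.1])
    (fun w hw => mul_ne_zero (hc0 _ hw.2) (zpow_ne_zero _ (den_ne_zero γ (hUH hw.2))))
  have hmem : ∀ z ∈ U, mob γ z ∈ upperHalf ∩ mob γ⁻¹ ⁻¹' U := fun z hz =>
    ⟨mob_mem γ (hUH hz), by rw [Set.mem_preimage, mob_inv_mob γ (hUH hz)]; exact hz⟩
  have main : ∀ j, IsSolutionOn (fun z => Q₂ (mob γ z) / den γ z ^ 4)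
      (fun z => Q₃ (mob γ z) / den γ z ^ 6 - 2 * (γ 1 0 : ℂ) * Q₂ (mob γ z) / den γ z ^ 5) U
      (fun z => F j z / c z) := by
    intro j
    set y : ℂ → ℂ := fun w => F j w / (c (mob γ⁻¹ w) * den γ (mob γ⁻¹ w) ^ (k + 2))
    have hy : ∀ x ∈ U, F j x / c x = den γ x ^ 2 * y (mob γ x) := by
      intro x hx
      have h0 := den_ne_zero γ (hUH hx)
      have h1 := hc0 x hx
      have h2 := zpow_ne_zero k h0
      simp only [y]
      rw [mob_inv_mob γ (hUH hx), hmod j γ x (hUH hx), zpow_add₀ h0, zpow_ofNat]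
      field_simp
    refine ⟨fun z hz => (hF j z (hUH hz)).div (hc z hz) (hc0 z hz), ?_⟩
    refine (eventually_codiscreteWithin_iff hU).2 fun z hz => ?_
    have h1 := (tendsto_mob_nhdsNE γ (hUH hz)).eventually
      ((eventually_codiscreteWithin_iff hU').1 (hsol j).2 _ (hmem z hz))
    filter_upwards [h1, nhdsWithin_le_nhds (hU.mem_nhds hz)] with x hx hxU
    have he : (fun z => F j z / c z) =ᶠ[𝓝 x] fun x => den γ x ^ 2 * y (mob γ x) :=
      eventually_of_mem (hU.mem_nhds hxU) hy
    have hbol := deriv_bol γ (hUH hxU) ((hsol j).1 _ (hmem x hxU))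
    have h0 := den_ne_zero γ (hUH hxU)
    rw [he.deriv_eq, he.deriv.deriv.deriv_eq, hbol.1, hbol.2, hy x hxU]
    have hx' : deriv (deriv (deriv y)) (mob γ x) + Q₂ (mob γ x) * deriv y (mob γ x) +
      Q₃ (mob γ x) * y (mob γ x) = 0 := hx
    have : deriv (deriv (deriv y)) (mob γ x) = -(Q₂ (mob γ x) * deriv y (mob γ x) +
      Q₃ (mob γ x) * y (mob γ x)) := by linear_combination hx'
    rw [this]
    field_simp
    ring
  exact ⟨main 0, main 1, main 2⟩

variable {k : ℤ} {F Φ : Fin 3 → ℂ → ℂ} {Q₂ Q₃ : ℂ → ℂ}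

/-- The transformation laws of the coefficients, from uniqueness applied to the pullback. -/
lemma IsEquationOf.transform (hF : HasIndependentQExpansions F Φ) (hmod : IsModularFamily k F)
    (hQ : IsEquationOf (F 0) (F 1) (F 2) Q₂ Q₃) (γ : SL(2, ℤ)) :
    ∀ᶠ z in codiscreteWithin upperHalf, Q₂ (mob γ z) = den γ z ^ 4 * Q₂ z ∧
      Q₃ (mob γ z) = den γ z ^ 6 * Q₃ z + 2 * (γ 1 0 : ℂ) * den γ z ^ 5 * Q₂ z := by
  filter_upwards [hQ.unique hF (hQ.pullback hF.analytic hmod γ), self_mem_codiscreteWithin _]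
    with z hz hzH
  have h0 := den_ne_zero γ hzH
  rw [hz.1, hz.2]
  constructor
  · field_simp
  · field_simp
    ring

lemma hasDerivAt_comp_exp {b : ℂ → ℂ} {z : ℂ} (hb : AnalyticAt ℂ b (exp (2 * Real.pi * I * z))) (a : ℂ) :
    HasDerivAt (fun x => a * b (exp (2 * Real.pi * I * x)))
      (a * (2 * Real.pi * I * euler 0 0 b (exp (2 * Real.pi * I * z)))) z := by
  have := (hasDerivAt_exp_mul (κ := 0) hb).const_mul a
  simpa using this

theorem IsEquationOf.isMODE (hF : HasIndependentQExpansions F Φ) (hmod : IsModularFamily k F)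
    (hQ : IsEquationOf (F 0) (F 1) (F 2) Q₂ Q₃) : IsMODE Q₂ Q₃ := by
  obtain ⟨_, _, b₁, b₀, -, hb₁, hb₀, h⟩ := hF.exists_coefficients
  obtain ⟨⟨Y, hY, hq⟩, -, -⟩ := h Q₂ Q₃ hQ
  refine ⟨⟨hQ.meromorphic₂, fun γ => ?_, ?_⟩, ⟨fun z hz => ?_, fun γ => ?_, ?_⟩⟩
  · filter_upwards [hQ.transform hF hmod γ] with z hz
    exact hz.1
  · exact ⟨fun q => (2 * Real.pi * I) ^ 2 * b₁ q, (analyticAt_const.mul hb₁).meromorphicAt, Y,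
      hq.mono fun z hz => hz.1⟩
  · exact (hQ.meromorphic₃ z hz).sub
      ((MeromorphicAt.const _ z).mul (hQ.meromorphic₂ z hz).deriv)
  · have htr := (eventually_codiscreteWithin_iff isOpen_upperHalf).1 (hQ.transform hF hmod γ)
    refine (eventually_codiscreteWithin_iff isOpen_upperHalf).2 fun z₀ hz₀ => ?_
    filter_upwards [htr z₀ hz₀, eventually_nhdsNE_eventually_nhds_iff.2 (htr z₀ hz₀),
      (hQ.meromorphic₂ z₀ hz₀).eventually_analyticAt,
      (tendsto_mob_nhdsNE γ hz₀).eventually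
        (hQ.meromorphic₂ _ (mob_mem γ hz₀)).eventually_analyticAt,
      nhdsWithin_le_nhds (isOpen_upperHalf.mem_nhds hz₀)] with z h1 h2 h3 h4 hz
    have h0 := den_ne_zero γ hz
    have h2' : (fun x => Q₂ (mob γ x)) =ᶠ[𝓝 z] fun x => den γ x ^ 4 * Q₂ x :=
      h2.mono fun x hx => hx.1
    have e1 : HasDerivAt (fun x => Q₂ (mob γ x)) (deriv Q₂ (mob γ z) * den γ z ^ (-2 : ℤ)) z :=
      h4.differentiableAt.hasDerivAt.comp z (hasDerivAt_mob γ hz)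
    have e2 := (((hasDerivAt_den γ z).fun_pow 4).fun_mul
      h3.differentiableAt.hasDerivAt).congr_of_eventuallyEq h2'
    have e3 := e1.unique e2
    simp only [zpow_neg, zpow_ofNat] at e3
    have e4 : deriv Q₂ (mob γ z) = den γ z ^ 2 *
        (4 * den γ z ^ 3 * (γ 1 0 : ℂ) * Q₂ z + den γ z ^ 4 * deriv Q₂ z) := by
      rw [← div_eq_mul_inv, div_eq_iff (pow_ne_zero 2 h0)] at e3
      rw [e3]
      push_cast
      ring
    change Q₃ (mob γ z) - 1 / 2 * deriv Q₂ (mob γ z) =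
      den γ z ^ (6 : ℤ) * (Q₃ z - 1 / 2 * deriv Q₂ z)
    rw [zpow_ofNat, e4, h1.2]
    ring
  · obtain ⟨Y', hY', hb'⟩ := exists_halfPlane hb₁.eventually_analyticAt
    refine ⟨fun q => (2 * Real.pi * I) ^ 3 * b₀ q -
      1 / 2 * ((2 * Real.pi * I) ^ 2 * (2 * Real.pi * I * euler 0 0 b₁ q)),
      ((analyticAt_const.mul hb₀).sub (analyticAt_const.mul (analyticAt_const.mul
        (analyticAt_const.mul (AnalyticAt.euler hb₁))))).meromorphicAt, max Y Y', ?_⟩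
    refine (eventually_codiscreteWithin_iff (isOpen_halfPlane _)).2 fun z₀ hz₀ => ?_
    have h1 := (eventually_codiscreteWithin_iff (isOpen_halfPlane _)).1 hq z₀
      (show Y < z₀.im from (le_max_left _ _).trans_lt hz₀)
    filter_upwards [h1, eventually_nhdsNE_eventually_nhds_iff.2 h1,
      nhdsWithin_le_nhds ((isOpen_halfPlane _).mem_nhds hz₀)] with z h2 h3 hz
    have h4 : Q₂ =ᶠ[𝓝 z] fun x => (2 * Real.pi * I) ^ 2 * b₁ (exp (2 * Real.pi * I * x)) :=
      h3.mono fun x hx => hx.1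
    rw [h2.2, h4.deriv_eq, (hasDerivAt_comp_exp (hb' z ((le_max_right _ _).trans_lt hz)) _).deriv]

/-! ### Local exponents -/

lemma le_meromorphicOrderAt_of_pow_mul {Q b : ℂ → ℂ} {z₀ : ℂ} {m : ℕ} (hQ : MeromorphicAt Q z₀)
    (hb : AnalyticAt ℂ b z₀) (h : ∀ᶠ z in 𝓝[≠] z₀, (z - z₀) ^ m * Q z = b z) :
    ((-m : ℤ) : WithTop ℤ) ≤ meromorphicOrderAt Q z₀ := by
  have hz : AnalyticAt ℂ (fun z => (z - z₀) ^ m) z₀ := by fun_prop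
  have h1 : 0 ≤ meromorphicOrderAt (fun z => (z - z₀) ^ m * Q z) z₀ := by
    rw [meromorphicOrderAt_congr h]
    exact hb.meromorphicOrderAt_nonneg
  rw [fun_meromorphicOrderAt_mul hz.meromorphicAt hQ, fun_meromorphicOrderAt_pow_id_sub_const] at h1
  cases hq : meromorphicOrderAt Q z₀ with
  | top => exact le_top
  | coe n =>
    rw [hq] at h1
    have h2 : (0 : ℤ) ≤ m + n := by exact_mod_cast h1
    have h3 : -(m : ℤ) ≤ n := by linarith
    exact_mod_cast h3

theorem IsEquationOf.h1 (hF : HasIndependentQExpansions F Φ)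
    (hQ : IsEquationOf (F 0) (F 1) (F 2) Q₂ Q₃) : H1 Q₂ Q₃ := by
  obtain ⟨_, _, b₁, b₀, -, hb₁, hb₀, h⟩ := hF.exists_coefficients
  obtain ⟨⟨Y, hY, hq⟩, -, -⟩ := h Q₂ Q₃ hQ
  refine ⟨fun z₀ hz₀ => ?_, fun z₀ hz₀ => ?_, ?_, ?_⟩
  · obtain ⟨_, _, _, _, c₁, c₀, -, -, hc₁, hc₀, h⟩ := exists_local_coefficients hz₀
      (fun j => hF.analytic j z₀ hz₀) (hF.independent z₀ hz₀)
    exact le_meromorphicOrderAt_of_pow_mul (m := 2) (hQ.meromorphic₂ z₀ hz₀) hc₁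
      ((h Q₂ Q₃ hQ).1.mono fun z hz => hz.1)
  · obtain ⟨_, _, _, _, c₁, c₀, -, -, hc₁, hc₀, h⟩ := exists_local_coefficients hz₀
      (fun j => hF.analytic j z₀ hz₀) (hF.independent z₀ hz₀)
    exact le_meromorphicOrderAt_of_pow_mul (m := 3) (hQ.meromorphic₃ z₀ hz₀) hc₀
      ((h Q₂ Q₃ hQ).1.mono fun z hz => hz.2)
  · exact ⟨_, fun q => (2 * Real.pi * I) ^ 2 * b₁ q, analyticAt_const.mul hb₁, rfl, Y,
      hq.mono fun z hz => hz.1⟩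
  · exact ⟨_, fun q => (2 * Real.pi * I) ^ 3 * b₀ q, analyticAt_const.mul hb₀, rfl, Y,
      hq.mono fun z hz => hz.2⟩

lemma strictMono_exponents {n : Fin 3 → ℕ} (hn : StrictMono n) (a : ℝ) :
    StrictMono fun j => (n j : ℝ) - a := fun i j h => by
  have : (n i : ℝ) < n j := by exact_mod_cast hn h
  linarith

lemma exponents_sub (n : Fin 3 → ℕ) (a : ℝ) (j : Fin 3) :
    ∃ m : ℤ, ((n j : ℝ) - a) - ((n 0 : ℝ) - a) = m := ⟨(n j : ℤ) - n 0, by push_cast; ring⟩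

/-- The local exponents at `z₀` are `n j - w / 3`, where `n 0 < n 1 < n 2` are the orders at `z₀` of
suitable linear combinations of the given functions and `w` is the order of the Wronskian. -/
theorem IsEquationOf.exists_isLocalExponents (hF : HasIndependentQExpansions F Φ)
    (hQ : IsEquationOf (F 0) (F 1) (F 2) Q₂ Q₃) {z₀ : ℂ} (hz₀ : z₀ ∈ upperHalf) :
    ∃ (v : Fin 3 → Fin 3 → ℂ) (n : Fin 3 → ℕ) (U : Fin 3 → ℂ → ℂ) (w : ℕ), StrictMono n ∧
      (∀ i, AnalyticAt ℂ (U i) z₀ ∧ U i z₀ ≠ 0 ∧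
        ∀ᶠ z in 𝓝 z₀, ∑ j, v i j * F j z = (z - z₀) ^ n i * U i z) ∧
      n 0 + n 1 + n 2 = w + 3 ∧
      IsLocalExponents Q₂ Q₃ z₀ fun j => (n j : ℝ) - (w : ℝ) / 3 := by
  obtain ⟨v, n, U, w, b₁, b₀, hn, hU, hb₁, hb₀, h⟩ := exists_local_coefficients hz₀
    (fun j => hF.analytic j z₀ hz₀) (hF.independent z₀ hz₀)
  obtain ⟨hq, hp, hs⟩ := h Q₂ Q₃ hQ
  refine ⟨v, n, U, w, hn, hU, hs, (strictMono_exponents hn _).monotone, b₁ z₀, b₀ z₀, ?_, ?_, ?_⟩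
  · exact (hb₁.continuousAt.tendsto.mono_left nhdsWithin_le_nhds).congr'
      (hq.mono fun z hz => hz.1.symm)
  · exact (hb₀.continuousAt.tendsto.mono_left nhdsWithin_le_nhds).congr'
      (hq.mono fun z hz => hz.2.symm)
  · rw [hp]
    push_cast
    rfl

theorem IsEquationOf.h2 (hF : HasIndependentQExpansions F Φ)
    (hQ : IsEquationOf (F 0) (F 1) (F 2) Q₂ Q₃) : H2 Q₂ Q₃ := by
  intro z₀ hz₀ _
  obtain ⟨v, n, U, w, hn, -, hs, hκ⟩ := hQ.exists_isLocalExponents hF hz₀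
  refine ⟨⟨_, hκ, strictMono_exponents hn _, ?_, exponents_sub n _⟩,
    isApparentAt hz₀ (fun j => hF.analytic j z₀ hz₀) (hF.independent z₀ hz₀) hQ⟩
  have h01 : n 0 < n 1 := hn (by decide)
  have h12 : n 1 < n 2 := hn (by decide)
  obtain ⟨m, hm⟩ : ∃ m : ℕ, w = 3 * n 0 + m := ⟨w - 3 * n 0, by omega⟩
  refine ⟨m, ?_⟩
  rw [hm]
  push_cast
  ring

theorem IsEquationOf.h3 (hF : HasIndependentQExpansions F Φ)
    (hQ : IsEquationOf (F 0) (F 1) (F 2) Q₂ Q₃) : H3 Q₂ Q₃ := by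
  obtain ⟨n, w, b₁, b₀, hn, hb₁, hb₀, h⟩ := hF.exists_coefficients
  obtain ⟨⟨Y, hY, hq⟩, hp, hs⟩ := h Q₂ Q₃ hQ
  have hpi : (2 * Real.pi * I : ℂ) ≠ 0 := two_pi_I_ne_zero
  refine ⟨fun j => (n j : ℝ) - (w : ℝ) / 3, ⟨(strictMono_exponents hn _).monotone, _, _,
    ⟨fun q => (2 * Real.pi * I) ^ 2 * b₁ q, analyticAt_const.mul hb₁, rfl, Y,
      hq.mono fun z hz => hz.1⟩,
    ⟨fun q => (2 * Real.pi * I) ^ 3 * b₀ q, analyticAt_const.mul hb₀, rfl, Y,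
      hq.mono fun z hz => hz.2⟩, ?_⟩, ?_, exponents_sub n _⟩
  · rw [mul_div_cancel_left₀ _ (pow_ne_zero 2 hpi), mul_div_cancel_left₀ _ (pow_ne_zero 3 hpi), hp]
    push_cast
    rfl
  · have h01 : n 0 < n 1 := hn (by decide)
    have h12 : n 1 < n 2 := hn (by decide)
    obtain ⟨m, hm⟩ : ∃ m : ℕ, w = 3 * n 0 + m := ⟨w - 3 * n 0, by omega⟩
    refine ⟨m, ?_⟩
    rw [hm]
    push_cast
    ring

/-! ### Elliptic points -/

/-- At a fixed point of `φ` with multiplier `μ`, a function with `G (φ z) = J z * G z` of order `n`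
satisfies `μ ^ n = J z₀`. -/
lemma multiplier_pow_eq {φ J G U : ℂ → ℂ} {z₀ μ : ℂ} {n : ℕ} (hφ : HasDerivAt φ μ z₀)
    (hfix : φ z₀ = z₀) (hJ : ContinuousAt J z₀) (hU : ContinuousAt U z₀) (hU0 : U z₀ ≠ 0)
    (hG : ∀ᶠ z in 𝓝 z₀, G z = (z - z₀) ^ n * U z) (hmod : ∀ᶠ z in 𝓝 z₀, G (φ z) = J z * G z) :
    μ ^ n = J z₀ := by
  have hφc : Tendsto φ (𝓝 z₀) (𝓝 z₀) := by simpa [ContinuousAt, hfix] using hφ.continuousAt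
  have h1 : Tendsto (fun z => slope φ z₀ z ^ n * U (φ z)) (𝓝[≠] z₀) (𝓝 (μ ^ n * U z₀)) :=
    ((hasDerivAt_iff_tendsto_slope.1 hφ).pow n).mul
      ((hU.tendsto.comp hφc).mono_left nhdsWithin_le_nhds)
  have h2 : Tendsto (fun z => J z * U z) (𝓝[≠] z₀) (𝓝 (J z₀ * U z₀)) :=
    (hJ.mul hU).tendsto.mono_left nhdsWithin_le_nhds
  refine mul_right_cancel₀ hU0 (tendsto_nhds_unique_of_eventuallyEq h1 h2 ?_)
  filter_upwards [nhdsWithin_le_nhds hmod, nhdsWithin_le_nhds hG,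
    nhdsWithin_le_nhds (hφc.eventually hG), self_mem_nhdsWithin] with z e1 e2 e3 hne
  have h0 : z - z₀ ≠ 0 := sub_ne_zero.2 hne
  rw [e2, e3] at e1
  rw [slope_def_field, hfix, div_pow, div_mul_eq_mul_div, div_eq_iff (pow_ne_zero n h0), e1]
  ring

lemma modEq_of_pow_eq_pow {μ : ℂ} {p : ℕ} (hp : p.Prime) (h1 : μ ^ p = 1) (hne : μ ≠ 1) {a b : ℕ}
    (h : μ ^ a = μ ^ b) : a ≡ b [MOD p] := by
  have := Fact.mk hp
  have ho : orderOf μ = p := orderOf_eq_prime h1 hne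
  have hμ : IsPrimitiveRoot μ p := ho ▸ IsPrimitiveRoot.orderOf μ
  rw [← pow_mod_orderOf μ a, ← pow_mod_orderOf μ b, ho] at h
  exact hμ.pow_inj (Nat.mod_lt _ hp.pos) (Nat.mod_lt _ hp.pos) h

/-- At an elliptic point whose stabilizer acts on the tangent space with prime order `p`, the orders
of all the forms are congruent modulo `p`. -/
theorem IsEquationOf.exists_isLocalExponents_elliptic (hF : HasIndependentQExpansions F Φ)
    (hmod : IsModularFamily k F) (hQ : IsEquationOf (F 0) (F 1) (F 2) Q₂ Q₃) {z₀ : ℂ}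
    (hz₀ : z₀ ∈ upperHalf) {γ : SL(2, ℤ)} (hfix : mob γ z₀ = z₀) {p : ℕ} (hp : p.Prime)
    (h1 : (den γ z₀ ^ (-2 : ℤ)) ^ p = 1) (hne : den γ z₀ ^ (-2 : ℤ) ≠ 1) :
    ∃ (n : Fin 3 → ℕ) (w : ℕ), n 0 + n 1 + n 2 = w + 3 ∧ (∀ i j, n i ≡ n j [MOD p]) ∧
      IsLocalExponents Q₂ Q₃ z₀ fun j => (n j : ℝ) - (w : ℝ) / 3 := by
  obtain ⟨v, n, U, w, -, hU, hs, hκ⟩ := hQ.exists_isLocalExponents hF hz₀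
  have key : ∀ i, (den γ z₀ ^ (-2 : ℤ)) ^ n i = den γ z₀ ^ k := by
    intro i
    refine multiplier_pow_eq (J := fun z => den γ z ^ k) (hasDerivAt_mob γ hz₀) hfix
      (hasDerivAt_den_zpow γ hz₀ k).continuousAt (hU i).1.continuousAt (hU i).2.1 (hU i).2.2 ?_
    filter_upwards [isOpen_upperHalf.mem_nhds hz₀] with z hz
    rw [Finset.mul_sum]
    refine Finset.sum_congr rfl fun j _ => ?_
    rw [hmod j γ z hz]
    ring
  exact ⟨n, w, hs, fun i j => modEq_of_pow_eq_pow hp h1 hne ((key i).trans (key j).symm), hκ⟩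

/-- The stabilizer of `i` is generated by `S`, with multiplier `-1`. -/
theorem IsEquationOf.exponents_I (hF : HasIndependentQExpansions F Φ)
    (hmod : IsModularFamily k F) (hQ : IsEquationOf (F 0) (F 1) (F 2) Q₂ Q₃) :
    ∃ κ : Fin 3 → ℝ, IsLocalExponents Q₂ Q₃ Complex.I κ ∧ ∀ j, ∃ m : ℤ, κ j - κ 0 = 2 * m := by
  have hden : den ModularGroup.S I = I := by simp [den, ModularGroup.S]
  have hden' : den ModularGroup.S I ^ (-2 : ℤ) = -1 := by
    rw [hden, zpow_neg, zpow_ofNat, I_sq]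
    norm_num
  obtain ⟨n, w, -, hn, hκ⟩ := hQ.exists_isLocalExponents_elliptic hF hmod (z₀ := I)
    (by simp [upperHalf]) (γ := ModularGroup.S)
    (by rw [mob, hden]; simp [ModularGroup.S]) Nat.prime_two
    (by rw [hden']; norm_num) (by rw [hden']; norm_num)
  refine ⟨_, hκ, fun j => ?_⟩
  obtain ⟨m, hm⟩ := (Nat.modEq_iff_dvd.1 (hn 0 j))
  refine ⟨m, ?_⟩
  have : (n j : ℝ) - n 0 = 2 * m := by exact_mod_cast hm
  linear_combination this

lemma rho_sq_add_rho_add_one : rho ^ 2 + rho + 1 = 0 := by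
  have h3 : (Real.sqrt 3 : ℂ) ^ 2 = 3 := by
    rw [← ofReal_pow, Real.sq_sqrt (by norm_num)]
    norm_num
  rw [rho]
  linear_combination (1 / 4) * (Real.sqrt 3 : ℂ) ^ 2 * I_sq - (1 / 4) * h3

lemma rho_mem : rho ∈ upperHalf := by
  have : rho.im = Real.sqrt 3 / 2 := by simp [rho]
  rw [upperHalf, Set.mem_ofPred_eq, this]
  positivity

/-- The element `S * T` fixes `ρ` with multiplier `ρ⁻¹`, a primitive third root of unity. -/
theorem IsEquationOf.exponents_rho (hF : HasIndependentQExpansions F Φ)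
    (hmod : IsModularFamily k F) (hQ : IsEquationOf (F 0) (F 1) (F 2) Q₂ Q₃) :
    ∃ κ : Fin 3 → ℝ, IsLocalExponents Q₂ Q₃ rho κ ∧
      ∃ n : Fin 3 → ℤ, (∀ j, κ j = n j) ∧ ∀ i j, n i ≡ n j [ZMOD 3] := by
  have hr := rho_sq_add_rho_add_one
  have hST : ∀ i j, (ModularGroup.S * ModularGroup.T) i j = !![0, -1; 1, 1] i j := by
    intro i j
    fin_cases i <;> fin_cases j <;> rfl
  have hden : den (ModularGroup.S * ModularGroup.T) rho = rho + 1 := by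
    simp only [den, hST]
    simp
  have hnum : mob (ModularGroup.S * ModularGroup.T) rho = -1 / (rho + 1) := by
    rw [mob, hden]
    simp only [hST]
    simp
  have hρ0 : rho ≠ 0 := fun h => by simp [h] at hr
  have hρ1 : rho + 1 ≠ 0 := fun h => by
    have : rho ^ 2 = 0 := by linear_combination hr - h
    exact hρ0 (by simpa using this)
  have hden' : den (ModularGroup.S * ModularGroup.T) rho ^ (-2 : ℤ) = rho⁻¹ := by
    rw [hden, zpow_neg, zpow_ofNat]
    congr 1
    linear_combination hr
  obtain ⟨n, w, hs, hn, hκ⟩ := hQ.exists_isLocalExponents_elliptic hF hmod rho_mem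
    (γ := ModularGroup.S * ModularGroup.T)
    (by rw [hnum, div_eq_iff hρ1]; linear_combination -hr) Nat.prime_three
    (by rw [hden', inv_pow, inv_eq_one]; linear_combination (rho - 1) * hr)
    (by
      rw [hden', ne_eq, inv_eq_one]
      intro h
      rw [h] at hr
      norm_num at hr)
  -- the sum of the three orders is divisible by `3`, hence so is the order of the Wronskian
  have h10 := hn 1 0
  have h20 := hn 2 0
  unfold Nat.ModEq at h10 h20
  obtain ⟨m, hm⟩ : ∃ m : ℕ, w = 3 * m := ⟨w / 3, by omega⟩
  refine ⟨_, hκ, fun j => (n j : ℤ) - m, fun j => ?_, fun i j => ?_⟩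
  · rw [hm]
    push_cast
    ring
  · exact ((Int.natCast_modEq_iff (n := 3)).2 (hn i j)).sub_right _

/-! ### Modular forms as functions of a complex variable -/

lemma toPlane_coe (f : ℍ → ℂ) (τ : ℍ) : toPlane f τ = f τ := by simp [toPlane]

lemma analyticOnNhd_toPlane {k : ℤ} (f : ModularForm 𝒮ℒ k) :
    AnalyticOnNhd ℂ (toPlane f) upperHalf :=
  (UpperHalfPlane.mdifferentiable_iff.1 f.holo').analyticOnNhd isOpen_upperHalf

lemma toPlane_mob {k : ℤ} (f : ModularForm 𝒮ℒ k) (γ : SL(2, ℤ)) {z : ℂ} (hz : z ∈ upperHalf) :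
    toPlane f (mob γ z) = den γ z ^ k * toPlane f z := by
  have h1 := toPlane_coe f (γ • ⟨z, hz⟩)
  have h2 := toPlane_coe f ⟨z, hz⟩
  rw [← mob_eq_coe_smul] at h1
  have hγ : Matrix.SpecialLinearGroup.mapGL ℝ γ ∈ 𝒮ℒ := ⟨γ, rfl⟩
  have h3 := SlashInvariantForm.slash_action_eqn' f hγ ⟨z, hz⟩
  rw [show toPlane f (mob γ z) = _ from h1, show toPlane f z = _ from h2]
  refine Eq.trans h3 ?_
  simp [den]

lemma hasIndependentQExpansions {k : ℤ} {f g h : ModularForm 𝒮ℒ k}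
    (hind : LinearIndependent ℂ ![f, g, h]) :
    HasIndependentQExpansions (fun j => toPlane (![f, g, h] j))
      (fun j => UpperHalfPlane.cuspFunction 1 (![f, g, h] j)) := by
  refine ⟨fun j => analyticOnNhd_toPlane _, fun z₀ hz₀ a ha => ?_, fun j => ?_, fun j z hz => ?_⟩
  · have hA : AnalyticOnNhd ℂ (fun z => ∑ j, a j * toPlane (![f, g, h] j) z) upperHalf :=
      fun z hz => by
        have := fun j => analyticOnNhd_toPlane (![f, g, h] j) z hz
        fun_prop
    have hconn : IsPreconnected upperHalf := isPreconnected_halfPlane 0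
    have h0 := hA.eqOn_zero_of_preconnected_of_eventuallyEq_zero hconn hz₀ ha
    funext j
    refine Fintype.linearIndependent_iff.1 hind a ?_ j
    ext τ
    have := h0 (x := (τ : ℂ)) τ.im_pos
    simpa [toPlane_coe, Fin.sum_univ_three] using this
  · exact ModularFormClass.analyticAt_cuspFunction_zero _ one_pos (by simp)
  · have := SlashInvariantFormClass.eq_cuspFunction (![f, g, h] j) (⟨z, hz⟩ : ℍ) (h := 1) (by simp)
      one_ne_zero
    have h2 := toPlane_coe (![f, g, h] j) ⟨z, hz⟩
    rw [← this] at h2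
    simpa [Function.Periodic.qParam] using h2

end ThirdOrderMODE

end

theorem mainTheorem5 (k : ℤ) (f g h : ModularForm 𝒮ℒ k)
    (hind : LinearIndependent ℂ ![f, g, h]) :
    -- the differential equation satisfied by the three quotients exists
    (∃ Q₂ Q₃ : ℂ → ℂ, ThirdOrderMODE.IsEquationOf (ThirdOrderMODE.toPlane f)
      (ThirdOrderMODE.toPlane g) (ThirdOrderMODE.toPlane h) Q₂ Q₃) ∧
    -- its coefficients are unique as meromorphic functions
    (∀ Q₂ Q₃ P₂ P₃ : ℂ → ℂ,
      ThirdOrderMODE.IsEquationOf (ThirdOrderMODE.toPlane f)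
        (ThirdOrderMODE.toPlane g) (ThirdOrderMODE.toPlane h) Q₂ Q₃ →
      ThirdOrderMODE.IsEquationOf (ThirdOrderMODE.toPlane f)
        (ThirdOrderMODE.toPlane g) (ThirdOrderMODE.toPlane h) P₂ P₃ →
      ∀ᶠ z in Filter.codiscreteWithin ThirdOrderMODE.upperHalf, Q₂ z = P₂ z ∧ Q₃ z = P₃ z) ∧
    -- its properties
    (∀ Q₂ Q₃ : ℂ → ℂ,
      ThirdOrderMODE.IsEquationOf (ThirdOrderMODE.toPlane f)
        (ThirdOrderMODE.toPlane g) (ThirdOrderMODE.toPlane h) Q₂ Q₃ →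
      ThirdOrderMODE.IsMODE Q₂ Q₃ ∧
      ThirdOrderMODE.H1 Q₂ Q₃ ∧ ThirdOrderMODE.H2 Q₂ Q₃ ∧ ThirdOrderMODE.H3 Q₂ Q₃ ∧
      ThirdOrderMODE.IsApparentAtInfty Q₂ Q₃ ∧
      (∃ κ : Fin 3 → ℝ, ThirdOrderMODE.IsLocalExponents Q₂ Q₃ Complex.I κ ∧
        ∀ j, ∃ m : ℤ, κ j - κ 0 = 2 * m) ∧
      (∃ κ : Fin 3 → ℝ, ThirdOrderMODE.IsLocalExponents Q₂ Q₃ ThirdOrderMODE.rho κ ∧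
        ∃ n : Fin 3 → ℤ, (∀ j, κ j = n j) ∧ ∀ i j, n i ≡ n j [ZMOD 3])) := by
  have hF := ThirdOrderMODE.hasIndependentQExpansions hind
  have hmod : ThirdOrderMODE.IsModularFamily k fun j => ThirdOrderMODE.toPlane (![f, g, h] j) :=
    fun j γ z hz => ThirdOrderMODE.toPlane_mob _ γ hz
  exact ⟨ThirdOrderMODE.exists_isEquationOf hF.analytic,
    fun Q₂ Q₃ P₂ P₃ hQ hP => ThirdOrderMODE.IsEquationOf.unique hF hQ hP,
    fun Q₂ Q₃ hQ => ⟨ThirdOrderMODE.IsEquationOf.isMODE hF hmod hQ,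
      ThirdOrderMODE.IsEquationOf.h1 hF hQ, ThirdOrderMODE.IsEquationOf.h2 hF hQ,
      ThirdOrderMODE.IsEquationOf.h3 hF hQ, hF.isApparentAtInfty hQ,
      ThirdOrderMODE.IsEquationOf.exponents_I hF hmod hQ,
      ThirdOrderMODE.IsEquationOf.exponents_rho hF hmod hQ⟩⟩
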